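/- Let $G \subset GL(n,\mathbb C)$ be a compact connected matrix Lie group with Lie algebra $\mathfrak g$. On $\mathbb R^{1+3}$ use Cartesian coordinates $(x^0,x^1,x^2,x^3)=(t,x)$, the Minkowski metric of signature $(-+++)$ and its Hodge star $\star$. Let $$\mathbb D=\{(t,x)\in\mathbb R^{1+3} : |x|\le t+1,\ |x|\le 1-t\},\qquad \partial^-\mathbb D=\{(t,x)\in\mathbb D : |x|=t+1\},$$ and, for a fixed $0<\epsilon_0<1$, let $\mho=\{(t,x)\in \operatorname{int}\mathbb D : |x|<\epsilon_0\}$. For a $\mathfrak g$-valued $1$-form $A$ write $d_A\omega=d\omega+[A,\omega]$, $F_A=dA+\tfrac12[A,A]$ and $d_A^*=\star d_A\star$. For $\mathbf U\in C^\infty(\mathbb D;G)$ write $\mathbf U\cdot B=\mathbf U^{-1}d\mathbf U+\mathbf U^{-1}B\mathbf U$. "Near $\partial^-\mathbb D$" means in the intersection of $\mathbb D$ with some open set containing $\partial^-\mathbb D$. Let $A,B\in C^3(\mathbb D;T^*\mathbb D\otimes\mathfrak g)$ be in temporal gauge, that is, $A_0=B_0=0$ in $\mathbb D$. Suppose that $d_A^*F_A=0=d_B^*F_B$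 in $\mathbb D\setminus\mho$ and that $d_A^*F_A=d_B^*F_B$ in $\mho$. Let $\mathbf U\in C^\infty(\mathbb D;G)$ and let $\mathcal N\supset\partial^-\mathbb D$ be an open set such that $A=\mathbf U\cdot B$ in $\mathcal N\cap\mathbb D$; suppose also that $\mathbf U=\mathrm{id}$ in $\mho$ near $\partial^-\mathbb D$. Then $\partial_t\mathbf U=0$ in $\mathcal N\cap\mathbb D$, and there is $\mathbf V\in C^\infty(\mathbb D;G)$ that does not depend on $t$ in $\mathbb D$, coincides with $\mathbf U$ near $\partial^-\mathbb D$ (so that necessarily $\mathbf V(t,x)=\mathbf U(|x|-1,x)$), and satisfies $A=\mathbf V\cdot B$ in all of $\mathbb D$. -/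

import Mathlib

open Set Topology
open scoped ContDiff Matrix.Norms.L2Operator

noncomputable section

namespace YM

/-- Space-time `ℝ^{1+3}`, with points `z = (t, x)`. -/
abbrev Spacetime : Type := ℝ × EuclideanSpace ℝ (Fin 3)

/-- The complex `n × n` matrices, as a real vector space. They carry the `ℓ²` operator norm. -/
abbrev Mat (n : ℕ) : Type := Matrix (Fin n) (Fin n) ℂ

/-! ### Minkowski space -/

/-- The Cartesian coordinate covectors `dx⁰ = dt, dx¹, dx², dx³`. -/
def dx (μ : Fin 4) : Spacetime →L[ℝ] ℝ :=
  Fin.cases (ContinuousLinearMap.fst ℝ ℝ (EuclideanSpace ℝ (Fin 3)))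
    (fun j => (EuclideanSpace.proj j).comp
      (ContinuousLinearMap.snd ℝ ℝ (EuclideanSpace ℝ (Fin 3)))) μ

/-- The Cartesian coordinate vectors `∂₀ = ∂_t, ∂₁, ∂₂, ∂₃`. -/
def e (μ : Fin 4) : Spacetime :=
  Fin.cases (1, 0) (fun j => (0, EuclideanSpace.single j 1)) μ

/-- The diagonal entries `g^{μμ}` of the (diagonal) Minkowski metric, of signature `(- + + +)`. -/
def g (μ : Fin 4) : ℝ := if μ = 0 then -1 else 1

/-- The volume form `dx⁰ ∧ dx¹ ∧ dx² ∧ dx³`. -/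
def vol : Spacetime [⋀^Fin 4]→L[ℝ] ℝ :=
  { (Matrix.detRowAlternating (R := ℝ) (n := Fin 4)).compLinearMap
      (LinearMap.pi fun μ => (dx μ).toLinearMap) with
    cont := by
      change Continuous fun v : Fin 4 → Spacetime => Matrix.det (Matrix.of fun i μ => dx μ (v i))
      exact Continuous.matrix_det (continuous_matrix fun i μ =>
        (dx μ).continuous.comp (continuous_apply i)) }

/-- The interior product `w(v₀, …, v_{k-1}, ·, …, ·)`. -/
def contract {l : ℕ} : (k : ℕ) → (Fin k → Spacetime) →
    (Spacetime [⋀^Fin (l + k)]→L[ℝ] ℝ) → (Spacetime [⋀^Fin l]→L[ℝ] ℝ)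
  | 0, _, w => w
  | k + 1, v, w => contract k (fun i => v i.succ)
      ((show Spacetime [⋀^Fin ((l + k) + 1)]→L[ℝ] ℝ from w).curryLeft (v 0))

/-- The Hodge star of a matrix-valued `k`-form (at a point), where `l = 4 - k`:
`(⋆η)(v₁, …, v_l) = (1/k!) ∑_α η^{α₁…α_k} vol(∂_{α₁}, …, ∂_{α_k}, v₁, …, v_l)`.
This is the map with `w ∧ ⋆η = ⟨w, η⟩ vol`. -/
def hodge {n k l : ℕ} (h : l + k = 4) (η : Spacetime [⋀^Fin k]→L[ℝ] Mat n) :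
    Spacetime [⋀^Fin l]→L[ℝ] Mat n :=
  ((k.factorial : ℝ)⁻¹) • ∑ α : Fin k → Fin 4,
    (∏ i, g (α i)) •
      (contract k (fun i => e (α i)) (h ▸ vol)).smulRight (η fun i => e (α i))

/-! ### The causal diamond -/

/-- The causal diamond `𝔻`. -/
def diamond : Set Spacetime := {z | ‖z.2‖ ≤ z.1 + 1 ∧ ‖z.2‖ ≤ 1 - z.1}

/-- The observation set `℧`. -/
def obs (ε₀ : ℝ) : Set Spacetime := {z | z ∈ interior diamond ∧ ‖z.2‖ < ε₀}

/-- The lower boundary `∂⁻𝔻`. -/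
def lowerBdry : Set Spacetime := {z | z ∈ diamond ∧ ‖z.2‖ = z.1 + 1}

/-! ### Matrix groups, connections and gauge transformations -/

/-- The Lie algebra of a closed matrix group. -/
def lieAlg {n : ℕ} (G : Subgroup (GL (Fin n) ℂ)) : Set (Mat n) :=
  {X | ∀ s : ℝ, ∃ a ∈ G, (a : Mat n) = NormedSpace.exp (s • X)}

/-- `A ∈ C³(𝔻; T*𝔻 ⊗ 𝔤)`, with derivatives up to the boundary of `𝔻`. -/
structure IsConnection {n : ℕ} (G : Subgroup (GL (Fin n) ℂ))
    (A : Spacetime → Spacetime →L[ℝ] Mat n) : Prop where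
  contDiffOn : ContDiffOn ℝ 3 A diamond
  mem_lieAlg : ∀ z ∈ diamond, ∀ v, A z v ∈ lieAlg G

/-- `U ∈ C^∞(𝔻; G)`, with derivatives up to the boundary of `𝔻`. -/
structure IsGauge {n : ℕ} (G : Subgroup (GL (Fin n) ℂ))
    (U : Spacetime → GL (Fin n) ℂ) : Prop where
  contDiffOn : ContDiffOn ℝ ∞ (fun z => (U z : Mat n)) diamond
  mem : ∀ z ∈ diamond, U z ∈ G

/-- The differential `dU` on `𝔻` of a gauge transformation. -/
def dGauge {n : ℕ} (U : Spacetime → GL (Fin n) ℂ) (z : Spacetime) : Spacetime →L[ℝ] Mat n :=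
  fderivWithin ℝ (fun y => (U y : Mat n)) diamond z

/-- The gauge action `U · B = U⁻¹ dU + U⁻¹ B U`. -/
def gaugeAct {n : ℕ} (U : Spacetime → GL (Fin n) ℂ) (B : Spacetime → Spacetime →L[ℝ] Mat n)
    (z : Spacetime) : Spacetime →L[ℝ] Mat n :=
  (ContinuousLinearMap.mul ℝ (Mat n) ((U z)⁻¹ : GL (Fin n) ℂ)).comp
    (dGauge U z + ((ContinuousLinearMap.mul ℝ (Mat n)).flip (U z : Mat n)).comp (B z))

/-- Temporal gauge: `A₀ = 0` in `𝔻`. -/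
def IsTemporal {n : ℕ} (A : Spacetime → Spacetime →L[ℝ] Mat n) : Prop :=
  ∀ z ∈ diamond, A z (e 0) = 0

/-! ### Covariant derivative and curvature -/

/-- The commutator `X ↦ (Y ↦ X Y - Y X)`. -/
def ad (n : ℕ) : Mat n →L[ℝ] Mat n →L[ℝ] Mat n :=
  ContinuousLinearMap.mul ℝ (Mat n) - (ContinuousLinearMap.mul ℝ (Mat n)).flip

/-- The pairing `[a, w] = a ∧ w - (-1)^k w ∧ a` of a `1`-form with a `k`-form (at a point), that is
`[a, w](v₀, …, v_k) = ∑ᵢ (-1)^i [a(vᵢ), w(v₀, …, v̂ᵢ, …, v_k)]`. -/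
def bracket {n k : ℕ} (a : Spacetime →L[ℝ] Mat n) (w : Spacetime [⋀^Fin k]→L[ℝ] Mat n) :
    Spacetime [⋀^Fin (k + 1)]→L[ℝ] Mat n :=
  .alternatizeUncurryFin
    (((ContinuousLinearMap.compContinuousAlternatingMapCLM ℝ Spacetime (Mat n) (Mat n)
      (ι := Fin k)).flip w).comp ((ad n).comp a))

/-- A `1`-form as an alternating form of degree `1`. -/
def oneForm {n : ℕ} (a : Spacetime →L[ℝ] Mat n) : Spacetime [⋀^Fin 1]→L[ℝ] Mat n :=
  ContinuousAlternatingMap.ofSubsingleton ℝ Spacetime (Mat n) (0 : Fin 1) a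

/-- The covariant derivative `d_A w = dw + [A, w]` on `𝔻`. -/
def covD {n k : ℕ} (A : Spacetime → Spacetime →L[ℝ] Mat n)
    (w : Spacetime → Spacetime [⋀^Fin k]→L[ℝ] Mat n) (z : Spacetime) :
    Spacetime [⋀^Fin (k + 1)]→L[ℝ] Mat n :=
  extDerivWithin w diamond z + bracket (A z) (w z)

/-- The curvature `F_A = dA + [A, A] / 2` on `𝔻`. -/
def curvature {n : ℕ} (A : Spacetime → Spacetime →L[ℝ] Mat n) (z : Spacetime) :
    Spacetime [⋀^Fin 2]→L[ℝ] Mat n :=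
  extDerivWithin (fun y => oneForm (A y)) diamond z
    + (2⁻¹ : ℝ) • bracket (A z) (oneForm (A z))

/-- The `1`-form `d_A^* F_A = ⋆ d_A ⋆ F_A` on `𝔻`. -/
def source {n : ℕ} (A : Spacetime → Spacetime →L[ℝ] Mat n) (z : Spacetime) :
    Spacetime [⋀^Fin 1]→L[ℝ] Mat n :=
  hodge (k := 3) (l := 1) rfl
    (covD A (fun y => hodge (k := 2) (l := 2) rfl (curvature A y)) z)

end YM

end

noncomputable section

namespace YM

/-! ### Geometry of the diamond -/

/-! Since `A` and `B` have no time component, the time component of `A = U · B` reads `∂ₜU = 0` near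
the lower boundary. This suggests extending `U` along vertical lines, `V(t, x) = U(|x| - 1, x)`
(`timeIndep`). The only obstruction to smoothness of `V` is the kink of `|x|` at the origin. It is
harmless because `U = 1` in `℧` near the lower boundary, so `V = 1` for `|x| < ε₀`.

The connection `V · B` is again temporal, because `V` does not depend on time. Its source matches
that of `A`: on `℧`, `V = 1` and the sources agree by assumption; elsewhere both sources vanish, a
condition that gauge covariance preserves (`mul_divComp_of_gauge`). The two connections agree near
the lower boundary, so it remains to prove uniqueness in temporal gauge (`eqOn_of_divComp_eq`).

For uniqueness, let `a`, `E`, `H` be the differences of the potentials `A_j`, of the electric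
components `F_{0j}` and of the magnetic components `F_{jk}`. Temporal gauge gives `∂ₜa = E`, the
spatial Yang–Mills equations give `∂ₜE = div H + O(1)`, and the Bianchi identity gives `∂ₜH = curl E
+ O(1)`, where `O(1)` is bounded by the differences on compact sets. This is a symmetric hyperbolic
system with speed one, without loss of derivatives; the time component of the source is never
needed. Multiplying the energy by a weight that decreases in time and vanishes before the upper
cone, then integrating the divergence over space-time, forces the energy to vanish
(`eq_zero_of_energy_estimate`). The argument takes place in the open diamond; continuity handles the
boundary.

The bridge between differential forms and coordinates is `source_apply`, which identifies the
spatial components of `⋆ d_A ⋆ F_A` with `-∇^μ F_{μk}`. -/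

theorem isClosed_diamond : IsClosed diamond :=
  (isClosed_le (f := fun z : Spacetime => ‖z.2‖) (g := fun z => z.1 + 1)
    (by fun_prop) (by fun_prop)).inter
  (isClosed_le (f := fun z : Spacetime => ‖z.2‖) (g := fun z => 1 - z.1)
    (by fun_prop) (by fun_prop))

theorem isCompact_diamond : IsCompact diamond := by
  refine Metric.isCompact_of_isClosed_isBounded isClosed_diamond ?_
  refine (Metric.isBounded_closedBall (x := (0 : Spacetime)) (r := 1)).subset fun z hz => ?_
  obtain ⟨h1, h2⟩ := hz
  have := norm_nonneg z.2
  rw [mem_closedBall_zero_iff, Prod.norm_def]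
  refine max_le ?_ (by linarith)
  rw [Real.norm_eq_abs, abs_le]
  constructor <;> linarith

theorem isCompact_lowerBdry : IsCompact lowerBdry :=
  isCompact_diamond.inter_right (isClosed_eq (by fun_prop) (by fun_prop))

theorem convex_diamond : Convex ℝ diamond := by
  have h : ConvexOn ℝ univ fun z : Spacetime => ‖z.2‖ :=
    (convexOn_norm (convex_univ (E := EuclideanSpace ℝ (Fin 3)))).comp_linearMap
      (LinearMap.snd ℝ ℝ (EuclideanSpace ℝ (Fin 3)))
  rintro y ⟨hy1, hy2⟩ z ⟨hz1, hz2⟩ a b ha hb hab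
  have := h.2 (mem_univ y) (mem_univ z) ha hb hab
  simp only [smul_eq_mul] at this
  constructor
  · refine this.trans ?_
    simp only [Prod.fst_add, Prod.smul_fst, smul_eq_mul]
    nlinarith
  · refine this.trans ?_
    simp only [Prod.fst_add, Prod.smul_fst, smul_eq_mul]
    nlinarith

theorem isOpen_strictDiamond :
    IsOpen {z : Spacetime | ‖z.2‖ < z.1 + 1 ∧ ‖z.2‖ < 1 - z.1} :=
  (isOpen_lt (f := fun z : Spacetime => ‖z.2‖) (g := fun z => z.1 + 1)
    (by fun_prop) (by fun_prop)).inter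
  (isOpen_lt (f := fun z : Spacetime => ‖z.2‖) (g := fun z => 1 - z.1)
    (by fun_prop) (by fun_prop))

theorem mem_interior_diamond {z : Spacetime} :
    z ∈ interior diamond ↔ ‖z.2‖ < z.1 + 1 ∧ ‖z.2‖ < 1 - z.1 := by
  constructor
  -- An interior point may be moved slightly down or up without leaving the diamond, which makes
  -- each of the two inequalities strict.
  · intro hz
    have hcont : ∀ c : ℝ, Filter.Tendsto (fun s : ℝ => ((z.1 + c * s, z.2) : Spacetime))
        (𝓝[>] 0) (𝓝 z) := fun c => by
      have : Continuous fun s : ℝ => ((z.1 + c * s, z.2) : Spacetime) := by fun_prop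
      simpa using (this.tendsto 0).mono_left nhdsWithin_le_nhds
    have key : ∀ c : ℝ, ∃ s : ℝ, 0 < s ∧ ((z.1 + c * s, z.2) : Spacetime) ∈ diamond := fun c => by
      have h := (hcont c).eventually (mem_interior_iff_mem_nhds.1 hz)
      obtain ⟨s, hs, hs0⟩ := (h.and self_mem_nhdsWithin).exists
      exact ⟨s, hs0, hs⟩
    obtain ⟨s, hs, h1, -⟩ := key (-1)
    obtain ⟨s', hs', -, h2⟩ := key 1
    simp only at h1 h2
    constructor <;> linarith
  · have h : {z : Spacetime | ‖z.2‖ < z.1 + 1 ∧ ‖z.2‖ < 1 - z.1} ⊆ diamond :=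
      fun y hy => ⟨hy.1.le, hy.2.le⟩
    exact fun hz => interior_maximal h isOpen_strictDiamond hz

theorem zero_mem_interior_diamond : (0 : Spacetime) ∈ interior diamond := by
  simp [mem_interior_diamond]

theorem uniqueDiffOn_diamond : UniqueDiffOn ℝ diamond :=
  uniqueDiffOn_convex convex_diamond ⟨0, zero_mem_interior_diamond⟩

theorem closure_interior_diamond : closure (interior diamond) = diamond := by
  rw [convex_diamond.closure_interior_eq_closure_of_nonempty_interior
    ⟨0, zero_mem_interior_diamond⟩, isClosed_diamond.closure_eq]

theorem mem_interior_of_notMem_lowerBdry {z : Spacetime} (hz : z ∈ diamond)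
    (hl : z ∉ lowerBdry) (hu : ‖z.2‖ < 1 - z.1) : z ∈ interior diamond :=
  mem_interior_diamond.2 ⟨lt_of_le_of_ne hz.1 fun h => hl ⟨hz, h⟩, hu⟩

/-! ### Functions supported in the interior -/

variable {F : Type*} [NormedAddCommGroup F] [NormedSpace ℝ F]

/-- A `C^m` function on an open set that vanishes off a compact subset is globally `C^m`. -/
theorem contDiff_of_eq_zero_off_isCompact {E : Type*} [NormedAddCommGroup E] [NormedSpace ℝ E]
    {Ω K : Set E} {m : WithTop ℕ∞} (hΩ : IsOpen Ω) (hK : IsCompact K) (hKΩ : K ⊆ Ω) {f : E → F}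
    (hf : ContDiffOn ℝ m f Ω) (h0 : ∀ z ∉ K, f z = 0) : ContDiff ℝ m f := by
  rw [contDiff_iff_contDiffAt]
  intro z
  by_cases hz : z ∈ Ω
  · exact hf.contDiffAt (hΩ.mem_nhds hz)
  · have : f =ᶠ[𝓝 z] fun _ => 0 := by
      filter_upwards [hK.isClosed.isOpen_compl.mem_nhds fun h => hz (hKΩ h)] with y hy
      exact h0 y hy
    exact contDiffAt_const.congr_of_eventuallyEq this

open MeasureTheory in
/-- The integral of a derivative of a compactly supported `C¹` function vanishes. -/
theorem integral_fderiv_apply_eq_zero {E : Type*} [NormedAddCommGroup E] [NormedSpace ℝ E]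
    [FiniteDimensional ℝ E] [MeasurableSpace E] [BorelSpace E] (μ : Measure E)
    [μ.IsAddHaarMeasure] {f : E → ℝ} (hf : ContDiff ℝ 1 f) (hc : HasCompactSupport f) (v : E) :
    ∫ z, fderiv ℝ f z v ∂μ = 0 := by
  have hi : Integrable f μ := hf.continuous.integrable_of_hasCompactSupport hc
  have hi' : Integrable (fun z => fderiv ℝ f z v) μ :=
    ((hf.continuous_fderiv one_ne_zero).clm_apply continuous_const).integrable_of_hasCompactSupport
      (hc.fderiv_apply ℝ v)
  -- Integration by parts against the constant function `1`.
  have := integral_mul_fderiv_eq_neg_fderiv_mul_of_integrable (μ := μ) (f := fun _ : E => (1 : ℝ))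
    (g := f) (v := v) (by simp) (by simpa using hi') (by simpa using hi)
    (by intros; fun_prop) (fun z _ => hf.differentiable one_ne_zero z)
  simpa using this

/-! ### Pointwise inequalities for the energy -/

section Pointwise

open scoped RealInnerProductSpace

variable {W : Type*} [NormedAddCommGroup W] [InnerProductSpace ℝ W]

/-- The energy density of `(a, E, H)`. -/
def energy (a E : Fin 3 → W) (H : Fin 3 → Fin 3 → W) : ℝ :=
  2⁻¹ * (∑ k, ⟪E k, E k⟫ + 2⁻¹ * ∑ j, ∑ k, ⟪H j k, H j k⟫ + ∑ j, ⟪a j, a j⟫)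

/-- The `ℓ¹` size of `(a, E, H)`. -/
def size {W : Type*} [NormedAddCommGroup W] (a E : Fin 3 → W) (H : Fin 3 → Fin 3 → W) : ℝ :=
  ∑ j, ‖a j‖ + ∑ j, ‖E j‖ + ∑ j, ∑ k, ‖H j k‖

theorem size_nonneg {W : Type*} [NormedAddCommGroup W] (a E : Fin 3 → W)
    (H : Fin 3 → Fin 3 → W) : 0 ≤ size a E H := by
  unfold size; positivity

theorem energy_nonneg (a E : Fin 3 → W) (H : Fin 3 → Fin 3 → W) : 0 ≤ energy a E H := by
  unfold energy
  simp only [real_inner_self_eq_norm_sq]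
  positivity

/-- Cauchy–Schwarz costs factors 3, 3, 9 on the three sums. With `(x + y + w)² ≤ 5x² + 5y² +
(5/3)w²` this is 15 times each sum of squares, and the `H` part enters the energy with weight 1/4,
whence 60. -/
theorem size_sq_le (a E : Fin 3 → W) (H : Fin 3 → Fin 3 → W) :
    size a E H ^ 2 ≤ 60 * energy a E H := by
  have hs : ∀ f : Fin 3 → ℝ, (∑ j, f j) ^ 2 ≤ 3 * ∑ j, f j ^ 2 := fun f => by
    simpa using sq_sum_le_card_mul_sum_sq (s := Finset.univ) (f := f)
  have h1 := hs fun j => ‖a j‖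
  have h2 := hs fun j => ‖E j‖
  have h3 : (∑ j, ∑ k, ‖H j k‖) ^ 2 ≤ 9 * ∑ j, ∑ k, ‖H j k‖ ^ 2 := by
    refine (hs _).trans ?_
    have : ∑ j, (∑ k, ‖H j k‖) ^ 2 ≤ ∑ j, 3 * ∑ k, ‖H j k‖ ^ 2 :=
      Finset.sum_le_sum fun j _ => hs _
    rw [← Finset.mul_sum] at this
    linarith
  unfold size energy
  simp only [real_inner_self_eq_norm_sq]
  generalize ∑ j, ‖a j‖ = x at *
  generalize ∑ j, ‖E j‖ = y at *
  generalize ∑ j, ∑ k, ‖H j k‖ = w at *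
  have p1 : 0 ≤ ∑ j, ‖a j‖ ^ 2 := by positivity
  have p2 : 0 ≤ ∑ j, ‖E j‖ ^ 2 := by positivity
  nlinarith [sq_nonneg (x - y), sq_nonneg (3 * x - w), sq_nonneg (3 * y - w)]

theorem eq_zero_of_energy_eq_zero {a E : Fin 3 → W} {H : Fin 3 → Fin 3 → W}
    (h : energy a E H = 0) (j : Fin 3) : a j = 0 := by
  have h1 := size_sq_le a E H
  rw [h, mul_zero] at h1
  have h2 : size a E H = 0 := pow_eq_zero_iff two_ne_zero |>.1 (le_antisymm h1 (sq_nonneg _))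
  have h3 : ‖a j‖ ≤ ∑ j, ‖a j‖ :=
    Finset.single_le_sum (f := fun j => ‖a j‖) (fun _ _ => norm_nonneg _) (Finset.mem_univ j)
  have h4 : 0 ≤ ∑ j, ‖E j‖ + ∑ j, ∑ k, ‖H j k‖ := by positivity
  unfold size at h2
  exact norm_le_zero_iff.1 (by linarith)

/-- Energy propagates with speed at most one. -/
theorem flux_le_energy (a E : Fin 3 → W) {H : Fin 3 → Fin 3 → W}
    (hH : ∀ j k, H j k = -H k j) (ν : Fin 3 → ℝ) (hν : ∑ j, ν j ^ 2 ≤ 1) :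
    ∑ j, ν j * ∑ k, ⟪E k, H j k⟫ ≤ energy a E H := by
  have h1 : 2 * ∑ j, ν j * ∑ k, ⟪E k, H j k⟫ = ∑ j, ∑ k, ⟪ν j • E k - ν k • E j, H j k⟫ := by
    simp only [inner_sub_left, real_inner_smul_left, Finset.sum_sub_distrib]
    rw [Finset.sum_comm (f := fun j k => ν k * ⟪E j, H j k⟫), two_mul, sub_eq_add_neg]
    simp only [Finset.mul_sum, ← Finset.sum_neg_distrib]
    congr 1
    refine Finset.sum_congr rfl fun j _ => Finset.sum_congr rfl fun k _ => ?_
    rw [hH j k, inner_neg_right]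
    ring
  have h2 : ∀ x y : W, ⟪x, y⟫ ≤ 2⁻¹ * ⟪x, x⟫ + 2⁻¹ * ⟪y, y⟫ := fun x y => by
    have := real_inner_self_nonneg (x := x - y)
    rw [real_inner_sub_sub_self] at this
    linarith
  -- Lagrange's identity: antisymmetrizing gives `2(|ν|²|E|² - |ν · E|²)`, so only `|ν| ≤ 1` is
  -- needed to compare the flux with the energy.
  have h3 : ∑ j, ∑ k, ⟪ν j • E k - ν k • E j, ν j • E k - ν k • E j⟫ =
      2 * ((∑ j, ν j ^ 2) * ∑ k, ⟪E k, E k⟫) - 2 * ⟪∑ j, ν j • E j, ∑ j, ν j • E j⟫ := by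
    simp only [Fin.sum_univ_three, inner_sub_left, inner_sub_right, inner_add_left,
      inner_add_right, real_inner_smul_left, real_inner_smul_right]
    rw [real_inner_comm (E 0) (E 1), real_inner_comm (E 0) (E 2), real_inner_comm (E 1) (E 2)]
    ring
  have h4 : ∑ j, ∑ k, ⟪ν j • E k - ν k • E j, H j k⟫ ≤
      2⁻¹ * ∑ j, ∑ k, ⟪ν j • E k - ν k • E j, ν j • E k - ν k • E j⟫ +
        2⁻¹ * ∑ j, ∑ k, ⟪H j k, H j k⟫ := by
    simp only [Finset.mul_sum, ← Finset.sum_add_distrib]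
    exact Finset.sum_le_sum fun j _ => Finset.sum_le_sum fun k _ => h2 _ _
  have h5 : (∑ j, ν j ^ 2) * ∑ k, ⟪E k, E k⟫ ≤ ∑ k, ⟪E k, E k⟫ :=
    mul_le_of_le_one_left (Finset.sum_nonneg fun k _ => real_inner_self_nonneg) hν
  have h6 : 0 ≤ ∑ j, ⟪a j, a j⟫ := Finset.sum_nonneg fun k _ => real_inner_self_nonneg
  have h7 := real_inner_self_nonneg (x := ∑ j, ν j • E j)
  unfold energy
  linarith

/-- The local energy balance: `dE`, `dH` stand for the spatial derivatives of `E`, `H`. -/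
theorem energy_balance_le {a E a' E' : Fin 3 → W} {H H' : Fin 3 → Fin 3 → W}
    (hH : ∀ j k, H j k = -H k j) (dE : Fin 3 → Fin 3 → W) (dH : Fin 3 → Fin 3 → W) {C : ℝ}
    (hC : 0 ≤ C) (ha' : ∀ j, ‖a' j‖ ≤ C * size a E H)
    (hE' : ∀ k, ‖E' k - ∑ j, dH j k‖ ≤ C * size a E H)
    (hH' : ∀ j k, ‖H' j k - (dE j k - dE k j)‖ ≤ C * size a E H) :
    (∑ k, ⟪E k, E' k⟫ + 2⁻¹ * ∑ j, ∑ k, ⟪H j k, H' j k⟫ + ∑ j, ⟪a j, a' j⟫) -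
      ∑ j, ∑ k, (⟪E k, dH j k⟫ + ⟪dE j k, H j k⟫) ≤ 60 * C * energy a E H := by
  set S := size a E H with hS
  have hS0 : 0 ≤ S := size_nonneg a E H
  have hb : ∀ x y : W, ‖y‖ ≤ C * S → ⟪x, y⟫ ≤ ‖x‖ * (C * S) := fun x y hy =>
    (real_inner_le_norm x y).trans (mul_le_mul_of_nonneg_left hy (norm_nonneg x))
  have h1 : ∑ k, ⟪E k, E' k - ∑ j, dH j k⟫ ≤ ∑ k, ‖E k‖ * (C * S) :=
    Finset.sum_le_sum fun k _ => hb _ _ (hE' k)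
  have h2 : ∑ j, ∑ k, ⟪H j k, H' j k - (dE j k - dE k j)⟫ ≤ ∑ j, ∑ k, ‖H j k‖ * (C * S) :=
    Finset.sum_le_sum fun j _ => Finset.sum_le_sum fun k _ => hb _ _ (hH' j k)
  have h3 : ∑ j, ⟪a j, a' j⟫ ≤ ∑ j, ‖a j‖ * (C * S) :=
    Finset.sum_le_sum fun k _ => hb _ _ (ha' k)
  -- The principal terms add up exactly to the divergence of the flux `∑ ⟪E k, H j k⟫`; only the
  -- errors remain, and these are quadratic in the field.
  have e1 : ∑ k, ⟪E k, E' k - ∑ j, dH j k⟫ = ∑ k, ⟪E k, E' k⟫ - ∑ j, ∑ k, ⟪E k, dH j k⟫ := by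
    simp only [inner_sub_right, Finset.sum_sub_distrib, inner_sum]
    rw [Finset.sum_comm]
  have e2 : ∑ j, ∑ k, ⟪H j k, H' j k - (dE j k - dE k j)⟫ =
      ∑ j, ∑ k, ⟪H j k, H' j k⟫ - 2 * ∑ j, ∑ k, ⟪dE j k, H j k⟫ := by
    have : ∑ j, ∑ k, ⟪H j k, dE k j⟫ = -∑ j, ∑ k, ⟪H j k, dE j k⟫ := by
      rw [Finset.sum_comm]
      simp only [← Finset.sum_neg_distrib]
      refine Finset.sum_congr rfl fun j _ => Finset.sum_congr rfl fun k _ => ?_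
      rw [hH k j, inner_neg_left]
    simp only [inner_sub_right, Finset.sum_sub_distrib, this, real_inner_comm (H _ _) (dE _ _)]
    ring
  rw [← Finset.sum_mul] at h1 h3
  simp only [← Finset.sum_mul] at h2
  have h4 := size_sq_le a E H
  rw [← hS] at h4
  have h5 : S = ∑ j, ‖a j‖ + ∑ j, ‖E j‖ + ∑ j, ∑ k, ‖H j k‖ := hS
  have h6 : 0 ≤ (∑ j, ∑ k, ‖H j k‖) * (C * S) := by positivity
  simp only [Finset.sum_add_distrib]
  rw [e1] at h1
  rw [e2] at h2
  have h7 : C * S ^ 2 = (∑ j, ‖a j‖ + ∑ j, ‖E j‖ + ∑ j, ∑ k, ‖H j k‖) * (C * S) := by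
    rw [← h5]; ring
  have h8 : C * S ^ 2 ≤ C * (60 * energy a E H) := mul_le_mul_of_nonneg_left h4 hC
  nlinarith

end Pointwise

/-! ### The cutoff -/

section Cutoff

open scoped RealInnerProductSpace

/-- A weight supported in `{√(η² + |x|²) ≤ 1 - t}`, decreasing in `t`. -/
def cutoff (lam η : ℝ) (z : Spacetime) : ℝ :=
  Real.exp (-lam * z.1) * expNegInvGlue (1 - z.1 - √(η ^ 2 + ‖z.2‖ ^ 2))

theorem cutoff_nonneg (lam η : ℝ) (z : Spacetime) : 0 ≤ cutoff lam η z :=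
  mul_nonneg (Real.exp_pos _).le (expNegInvGlue.nonneg _)

theorem cutoff_eq_zero {lam η : ℝ} {z : Spacetime} (h : 1 - z.1 ≤ √(η ^ 2 + ‖z.2‖ ^ 2)) :
    cutoff lam η z = 0 := by
  rw [cutoff, expNegInvGlue.zero_of_nonpos (by linarith), mul_zero]

theorem cutoff_pos {lam η : ℝ} {z : Spacetime} (h : √(η ^ 2 + ‖z.2‖ ^ 2) < 1 - z.1) :
    0 < cutoff lam η z :=
  mul_pos (Real.exp_pos _) (expNegInvGlue.pos_of_pos (by linarith))

/-- Taking `η > 0` replaces the cone by a hyperboloid and removes the singularity of `|x|` on the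
time axis. -/
theorem contDiff_cutoff (lam : ℝ) {η : ℝ} (hη : 0 < η) : ContDiff ℝ 1 (cutoff lam η) := by
  have h1 : ContDiff ℝ 1 fun z : Spacetime => √(η ^ 2 + ‖z.2‖ ^ 2) :=
    (contDiff_const.add ((contDiff_norm_sq ℝ).comp contDiff_snd)).sqrt fun z =>
      (add_pos_of_pos_of_nonneg (pow_pos hη 2) (sq_nonneg ‖z.2‖)).ne'
  have h2 : ContDiff ℝ 1 fun z : Spacetime => 1 - z.1 - √(η ^ 2 + ‖z.2‖ ^ 2) :=
    (contDiff_const.sub contDiff_fst).sub h1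
  exact (Real.contDiff_exp.comp (contDiff_const.mul contDiff_fst)).mul
    ((expNegInvGlue.contDiff (n := 1)).comp h2)

/-- The derivative of the cutoff in the variable transverse to the cones. -/
def cutoffSlope (lam η : ℝ) (z : Spacetime) : ℝ :=
  Real.exp (-lam * z.1) * deriv expNegInvGlue (1 - z.1 - √(η ^ 2 + ‖z.2‖ ^ 2))

theorem cutoffSlope_nonneg (lam η : ℝ) (z : Spacetime) : 0 ≤ cutoffSlope lam η z :=
  mul_nonneg (Real.exp_pos _).le expNegInvGlue.monotone.deriv_nonneg

theorem fderiv_cutoff (lam : ℝ) {η : ℝ} (hη : 0 < η) (z v : Spacetime) :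
    fderiv ℝ (cutoff lam η) z v = -lam * v.1 * cutoff lam η z -
      cutoffSlope lam η z * (v.1 + ⟪z.2, v.2⟫ / √(η ^ 2 + ‖z.2‖ ^ 2)) := by
  have hpos : 0 < η ^ 2 + ‖z.2‖ ^ 2 := by positivity
  have hn : HasFDerivAt (fun y : Spacetime => ‖y.2‖ ^ 2)
      (2 • (innerSL ℝ z.2).comp (ContinuousLinearMap.snd ℝ ℝ (EuclideanSpace ℝ (Fin 3)))) z := by
    simpa using (hasFDerivAt_snd (𝕜 := ℝ) (p := z)).norm_sq
  have hs := (hn.const_add (η ^ 2)).sqrt hpos.ne'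
  have hr := (((hasFDerivAt_fst (𝕜 := ℝ) (p := z)).const_sub 1).sub hs)
  have hb : HasDerivAt expNegInvGlue (deriv expNegInvGlue (1 - z.1 - √(η ^ 2 + ‖z.2‖ ^ 2)))
      (1 - z.1 - √(η ^ 2 + ‖z.2‖ ^ 2)) :=
    ((expNegInvGlue.contDiff (n := 1)).differentiable one_ne_zero _).hasDerivAt
  have he := ((hasFDerivAt_fst (𝕜 := ℝ) (p := z)).const_mul (-lam)).exp
  have h := (he.mul (hb.comp_hasFDerivAt z hr)).fderiv
  have h' : fderiv ℝ (cutoff lam η) z = _ := h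
  rw [h']
  simp [cutoff, cutoffSlope]
  have := (Real.sqrt_pos.2 hpos).ne'
  field_simp
  ring

/-- This vector is the spatial gradient of `√(η² + |x|²)`. Length at most one means that the level
sets of the weight's profile are never timelike, as `flux_le_energy` requires. -/
theorem sum_sq_direction_le {η : ℝ} (x : EuclideanSpace ℝ (Fin 3)) :
    ∑ j, (x j / √(η ^ 2 + ‖x‖ ^ 2)) ^ 2 ≤ 1 := by
  have h : 0 ≤ η ^ 2 + ‖x‖ ^ 2 := by positivity
  simp only [div_pow, Real.sq_sqrt h, ← Finset.sum_div]
  refine div_le_one_of_le₀ ?_ h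
  rw [EuclideanSpace.norm_sq_eq]
  simp only [Real.norm_eq_abs, sq_abs]
  nlinarith [sq_nonneg η]

end Cutoff

/-! ### Uniqueness for the first-order system -/

section Uniqueness

open scoped RealInnerProductSpace

/-- The partial derivative in the `μ`-th coordinate direction. -/
def pd {F : Type*} [NormedAddCommGroup F] [NormedSpace ℝ F] (μ : Fin 4) (f : Spacetime → F)
    (z : Spacetime) : F :=
  fderiv ℝ f z (e μ)

variable {W : Type*} [NormedAddCommGroup W] [InnerProductSpace ℝ W]

theorem e_zero : e 0 = ((1, 0) : Spacetime) := rfl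

theorem e_succ (j : Fin 3) : e j.succ = ((0, EuclideanSpace.single j 1) : Spacetime) := rfl

theorem pd_cutoff_zero (lam : ℝ) {η : ℝ} (hη : 0 < η) (z : Spacetime) :
    pd 0 (cutoff lam η) z = -lam * cutoff lam η z - cutoffSlope lam η z := by
  rw [pd, fderiv_cutoff lam hη, e_zero]
  simp

theorem pd_cutoff_succ (lam : ℝ) {η : ℝ} (hη : 0 < η) (z : Spacetime) (j : Fin 3) :
    pd j.succ (cutoff lam η) z =
      -(cutoffSlope lam η z * (z.2 j / √(η ^ 2 + ‖z.2‖ ^ 2))) := by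
  rw [pd, fderiv_cutoff lam hη, e_succ]
  simp [EuclideanSpace.inner_single_right]

theorem pd_mul {f h : Spacetime → ℝ} {z : Spacetime} (μ : Fin 4) (hf : DifferentiableAt ℝ f z)
    (hh : DifferentiableAt ℝ h z) :
    pd μ (fun y => f y * h y) z = pd μ f z * h z + f z * pd μ h z := by
  simp only [pd]
  rw [fderiv_fun_mul hf hh]
  simp
  ring

theorem pd_inner {f h : Spacetime → W} {z : Spacetime} (μ : Fin 4) (hf : DifferentiableAt ℝ f z)
    (hh : DifferentiableAt ℝ h z) :
    pd μ (fun y => ⟪f y, h y⟫) z = ⟪f z, pd μ h z⟫ + ⟪pd μ f z, h z⟫ := by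
  simp only [pd]
  rw [fderiv_inner_apply ℝ hf hh]

theorem pd_sum {ι F : Type*} [NormedAddCommGroup F] [NormedSpace ℝ F] {s : Finset ι}
    {f : ι → Spacetime → F} {z : Spacetime} (μ : Fin 4)
    (hf : ∀ i ∈ s, DifferentiableAt ℝ (f i) z) :
    pd μ (fun y => ∑ i ∈ s, f i y) z = ∑ i ∈ s, pd μ (f i) z := by
  simp only [pd]
  rw [fderiv_fun_sum hf]
  simp

theorem pd_energy {a E : Fin 3 → Spacetime → W} {H : Fin 3 → Fin 3 → Spacetime → W}
    {z : Spacetime} (μ : Fin 4) (ha : ∀ j, DifferentiableAt ℝ (a j) z)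
    (hE : ∀ j, DifferentiableAt ℝ (E j) z) (hH : ∀ j k, DifferentiableAt ℝ (H j k) z) :
    pd μ (fun y => energy (a · y) (E · y) (H · · y)) z =
      ∑ k, ⟪E k z, pd μ (E k) z⟫ + 2⁻¹ * ∑ j, ∑ k, ⟪H j k z, pd μ (H j k) z⟫ +
        ∑ j, ⟪a j z, pd μ (a j) z⟫ := by
  have key : HasFDerivAt (fun y => energy (a · y) (E · y) (H · · y)) _ z :=
    HasFDerivAt.const_mul (((HasFDerivAt.fun_sum fun k _ =>
      (hE k).hasFDerivAt.inner ℝ (hE k).hasFDerivAt).add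
      ((HasFDerivAt.fun_sum fun j _ => HasFDerivAt.fun_sum fun k _ =>
        (hH j k).hasFDerivAt.inner ℝ (hH j k).hasFDerivAt).const_mul 2⁻¹)).add
      (HasFDerivAt.fun_sum fun j _ => (ha j).hasFDerivAt.inner ℝ (ha j).hasFDerivAt)) 2⁻¹
  rw [pd, key.fderiv]
  simp only [pd, _root_.smul_apply, _root_.add_apply,
    _root_.sum_apply, ContinuousLinearMap.comp_apply, ContinuousLinearMap.prod_apply,
    fderivInnerCLM_apply, smul_eq_mul]
  have hc : ∀ x y : W, ⟪x, y⟫ + ⟪y, x⟫ = 2 * ⟪x, y⟫ := fun x y => by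
    rw [real_inner_comm x y]; ring
  simp only [hc, ← Finset.mul_sum]
  ring

theorem contDiffOn_energy {Ω : Set Spacetime} {a E : Fin 3 → Spacetime → W}
    {H : Fin 3 → Fin 3 → Spacetime → W}
    (ha : ∀ j, ContDiffOn ℝ 1 (a j) Ω) (hE : ∀ j, ContDiffOn ℝ 1 (E j) Ω)
    (hH : ∀ j k, ContDiffOn ℝ 1 (H j k) Ω) :
    ContDiffOn ℝ 1 (fun y => energy (a · y) (E · y) (H · · y)) Ω :=
  contDiffOn_const.mul (((ContDiffOn.sum fun k _ => (hE k).inner ℝ (hE k)).add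
    (contDiffOn_const.mul (ContDiffOn.sum fun j _ => ContDiffOn.sum fun k _ =>
      (hH j k).inner ℝ (hH j k)))).add (ContDiffOn.sum fun j _ => (ha j).inner ℝ (ha j)))

/-- The pointwise form of the weighted energy inequality. -/
theorem weighted_energy_balance {a E : Fin 3 → Spacetime → W} {H : Fin 3 → Fin 3 → Spacetime → W}
    {z : Spacetime} {C lam η : ℝ} (hη : 0 < η) (hC : 0 ≤ C) (hlam : 60 * C + 1 ≤ lam)
    (ha : ∀ j, DifferentiableAt ℝ (a j) z)
    (hE : ∀ j, DifferentiableAt ℝ (E j) z) (hH : ∀ j k, DifferentiableAt ℝ (H j k) z)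
    (hanti : ∀ j k, H j k z = -H k j z)
    (ha' : ∀ j, ‖pd 0 (a j) z‖ ≤ C * size (a · z) (E · z) (H · · z))
    (hE' : ∀ k, ‖pd 0 (E k) z - ∑ j : Fin 3, pd j.succ (H j k) z‖ ≤
      C * size (a · z) (E · z) (H · · z))
    (hH' : ∀ j k, ‖pd 0 (H j k) z - (pd j.succ (E k) z - pd k.succ (E j) z)‖ ≤
      C * size (a · z) (E · z) (H · · z)) :
    pd 0 (fun y => cutoff lam η y * energy (a · y) (E · y) (H · · y)) z -
      ∑ j : Fin 3, pd j.succ (fun y => cutoff lam η y * ∑ k, ⟪E k y, H j k y⟫) z ≤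
    -(cutoff lam η z * energy (a · z) (E · z) (H · · z)) := by
  have hψ : DifferentiableAt ℝ (cutoff lam η) z :=
    (contDiff_cutoff lam hη).differentiable one_ne_zero z
  have hen : DifferentiableAt ℝ (fun y => energy (a · y) (E · y) (H · · y)) z := by
    unfold energy
    exact (((DifferentiableAt.fun_sum fun k _ => (hE k).inner ℝ (hE k)).add
      ((DifferentiableAt.fun_sum fun j _ => DifferentiableAt.fun_sum fun k _ =>
        (hH j k).inner ℝ (hH j k)).const_mul _)).add
      (DifferentiableAt.fun_sum fun j _ => (ha j).inner ℝ (ha j))).const_mul _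
  have hP : ∀ j, DifferentiableAt ℝ (fun y => ∑ k, ⟪E k y, H j k y⟫) z := fun j =>
    DifferentiableAt.fun_sum fun k _ => (hE k).inner ℝ (hH j k)
  have hPd : ∀ j : Fin 3, pd j.succ (fun y => cutoff lam η y * ∑ k, ⟪E k y, H j k y⟫) z =
      -(cutoffSlope lam η z) * ((z.2 j / √(η ^ 2 + ‖z.2‖ ^ 2)) * ∑ k, ⟪E k z, H j k z⟫) +
      cutoff lam η z * ∑ k, (⟪E k z, pd j.succ (H j k) z⟫ + ⟪pd j.succ (E k) z, H j k z⟫) := by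
    intro j
    rw [pd_mul _ hψ (hP j), pd_cutoff_succ lam hη,
      pd_sum _ fun k _ => (hE k).inner ℝ (hH j k)]
    simp only [pd_inner _ (hE _) (hH j _)]
    ring
  rw [pd_mul _ hψ hen, pd_cutoff_zero lam hη, pd_energy 0 ha hE hH]
  simp only [hPd, Finset.sum_add_distrib (f := fun j : Fin 3 => -(cutoffSlope lam η z) *
    ((z.2 j / √(η ^ 2 + ‖z.2‖ ^ 2)) * ∑ k, ⟪E k z, H j k z⟫)), ← Finset.mul_sum]
  have hflux := flux_le_energy (a · z) (E · z) (H := (H · · z)) hanti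
    (fun j => z.2 j / √(η ^ 2 + ‖z.2‖ ^ 2)) (sum_sq_direction_le z.2)
  have hbal := energy_balance_le (a := (a · z)) (E := (E · z)) (H := (H · · z)) hanti
    (fun j k => pd j.succ (E k) z) (fun j k => pd j.succ (H j k) z) hC ha' hE' hH'
  have hs := cutoffSlope_nonneg lam η z
  have hc := cutoff_nonneg lam η z
  have he := energy_nonneg (a · z) (E · z) (H · · z)
  -- The slope of the cutoff multiplies flux minus energy, which is nonpositive and may be dropped.
  -- The error `60 C` times the energy is absorbed by the factor `-lam` from the exponential, with
  -- one unit to spare.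
  have i1 := mul_le_mul_of_nonneg_left hflux hs
  have i2 := mul_le_mul_of_nonneg_left hbal hc
  have i3 := mul_le_mul_of_nonneg_right hlam (mul_nonneg hc he)
  linarith

open MeasureTheory in
/-- Energy uniqueness: a field `(a, E, H)` in the interior of the diamond that vanishes near the
lower boundary and solves `∂ₜa = O(1)`, `∂ₜE = div H + O(1)`, `∂ₜH = curl E + O(1)`, where `O(1)`
stands for terms controlled by the field, vanishes identically. -/
theorem eq_zero_of_energy_estimate {a E : Fin 3 → Spacetime → W}
    {H : Fin 3 → Fin 3 → Spacetime → W}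
    (ha : ∀ j, ContDiffOn ℝ 1 (a j) (interior diamond))
    (hE : ∀ j, ContDiffOn ℝ 1 (E j) (interior diamond))
    (hH : ∀ j k, ContDiffOn ℝ 1 (H j k) (interior diamond))
    (hanti : ∀ z ∈ interior diamond, ∀ j k, H j k z = -H k j z)
    {M : Set Spacetime} (hM : IsOpen M) (hMl : lowerBdry ⊆ M)
    (h0 : ∀ z ∈ M ∩ interior diamond,
      (∀ j, a j z = 0) ∧ (∀ j, E j z = 0) ∧ ∀ j k, H j k z = 0)
    (hest : ∀ K ⊆ interior diamond, IsCompact K → ∃ C : ℝ, ∀ z ∈ K,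
      (∀ j, ‖pd 0 (a j) z‖ ≤ C * size (a · z) (E · z) (H · · z)) ∧
      (∀ k, ‖pd 0 (E k) z - ∑ j : Fin 3, pd j.succ (H j k) z‖ ≤
        C * size (a · z) (E · z) (H · · z)) ∧
      (∀ j k, ‖pd 0 (H j k) z - (pd j.succ (E k) z - pd k.succ (E j) z)‖ ≤
        C * size (a · z) (E · z) (H · · z)))
    {z : Spacetime} (hz : z ∈ interior diamond) (j : Fin 3) : a j z = 0 := by
  -- Half the gap to the upper cone is small enough for the weight to be positive at `z`.
  obtain ⟨η, hη, hηz⟩ : ∃ η : ℝ, 0 < η ∧ √(η ^ 2 + ‖z.2‖ ^ 2) < 1 - z.1 := by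
    have h1 := (mem_interior_diamond.1 hz).2
    have h2 := norm_nonneg z.2
    refine ⟨(1 - z.1 - ‖z.2‖) / 2, by linarith, ?_⟩
    rw [Real.sqrt_lt' (by linarith)]
    nlinarith
  -- Off `K` either the weight or the field vanishes. The hyperboloid stays below the upper cone and
  -- `M` is removed around the lower boundary, so `K` is a compact subset of the open diamond. This
  -- permits extension by zero and a uniform constant.
  set K : Set Spacetime := (diamond ∩ {y | √(η ^ 2 + ‖y.2‖ ^ 2) ≤ 1 - y.1}) \ M with hKdef
  have hK : IsCompact K :=
    (isCompact_diamond.inter_right (isClosed_le (by fun_prop) (by fun_prop))).diff hM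
  have hKΩ : K ⊆ interior diamond := by
    rintro y ⟨⟨hy, hy'⟩, hyM⟩
    refine mem_interior_of_notMem_lowerBdry hy (fun h => hyM (hMl h)) (lt_of_lt_of_le ?_ hy')
    exact Real.lt_sqrt_of_sq_lt (by nlinarith [sq_pos_of_pos hη])
  obtain ⟨C, hC⟩ := hest K hKΩ hK
  have hC' : ∀ y, C * size (a · y) (E · y) (H · · y) ≤ |C| * size (a · y) (E · y) (H · · y) :=
    fun y => mul_le_mul_of_nonneg_right (le_abs_self C) (size_nonneg _ _ _)
  set lam : ℝ := 60 * |C| + 1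
  set X : Spacetime → ℝ := (interior diamond).indicator
    fun y => cutoff lam η y * energy (a · y) (E · y) (H · · y) with hX
  set Y : Fin 3 → Spacetime → ℝ := fun j => (interior diamond).indicator
    fun y => cutoff lam η y * ∑ k, ⟪E k y, H j k y⟫ with hY
  have hcut : ContDiffOn ℝ 1 (cutoff lam η) (interior diamond) :=
    (contDiff_cutoff lam hη).contDiffOn
  have hoff : ∀ y ∉ K, y ∈ interior diamond →
      cutoff lam η y = 0 ∨ ((∀ j, a j y = 0) ∧ (∀ j, E j y = 0) ∧ ∀ j k, H j k y = 0) := by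
    intro y hy hyΩ
    by_cases hyM : y ∈ M
    · exact Or.inr (h0 y ⟨hyM, hyΩ⟩)
    · refine Or.inl (cutoff_eq_zero (le_of_not_ge fun h => hy ⟨⟨interior_subset hyΩ, h⟩, hyM⟩))
  have hX0 : ∀ y ∉ K, X y = 0 := by
    intro y hy
    by_cases hyΩ : y ∈ interior diamond
    · rw [hX, indicator_of_mem hyΩ]
      rcases hoff y hy hyΩ with h | ⟨h1, h2, h3⟩
      · rw [h, zero_mul]
      · simp [energy, h1, h2, h3]
    · exact indicator_of_notMem hyΩ _
  have hY0 : ∀ j, ∀ y ∉ K, Y j y = 0 := by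
    intro j y hy
    by_cases hyΩ : y ∈ interior diamond
    · rw [hY]
      simp only [indicator_of_mem hyΩ]
      rcases hoff y hy hyΩ with h | ⟨h1, h2, h3⟩
      · rw [h, zero_mul]
      · simp [h2]
    · exact indicator_of_notMem hyΩ _
  have hXc : ContDiff ℝ 1 X := contDiff_of_eq_zero_off_isCompact isOpen_interior hK hKΩ
    ((hcut.mul (contDiffOn_energy ha hE hH)).congr fun y hy => indicator_of_mem hy _) hX0
  have hYc : ∀ j, ContDiff ℝ 1 (Y j) := fun j =>
    contDiff_of_eq_zero_off_isCompact isOpen_interior hK hKΩ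
      ((hcut.mul (ContDiffOn.sum fun k _ => (hE k).inner ℝ (hH j k))).congr
        fun y hy => indicator_of_mem hy _) (hY0 j)
  have hXs : HasCompactSupport X := HasCompactSupport.intro hK hX0
  have hYs : ∀ j, HasCompactSupport (Y j) := fun j => HasCompactSupport.intro hK (hY0 j)
  have hint : ∀ {f : Spacetime → ℝ}, ContDiff ℝ 1 f → HasCompactSupport f → ∀ μ,
      Integrable (fun y => pd μ f y) := fun hf hfs μ =>
    ((hf.continuous_fderiv one_ne_zero).clm_apply continuous_const).integrable_of_hasCompactSupport
      (hfs.fderiv_apply ℝ _)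
  have hzero : ∀ {f : Spacetime → ℝ}, ContDiff ℝ 1 f → HasCompactSupport f → ∀ μ,
      ∫ y, pd μ f y = 0 := fun hf hfs μ =>
    haveI : (volume : Measure Spacetime).IsAddHaarMeasure :=
      inferInstanceAs ((volume : Measure ℝ).prod
        (volume : Measure (EuclideanSpace ℝ (Fin 3)))).IsAddHaarMeasure
    integral_fderiv_apply_eq_zero volume hf hfs _
  -- The right side is a divergence of compactly supported fields, so its integral is zero.
  have hle : ∀ y, X y ≤ -(pd 0 X y - ∑ j : Fin 3, pd j.succ (Y j) y) := by
    intro y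
    by_cases hy : y ∈ K
    · have hyΩ := hKΩ hy
      have hn := isOpen_interior.mem_nhds hyΩ
      have hev : ∀ f : Spacetime → ℝ, (interior diamond).indicator f =ᶠ[𝓝 y] f := fun f =>
        Filter.eventuallyEq_of_mem hn fun w hw => indicator_of_mem hw f
      have hpd : ∀ μ (f : Spacetime → ℝ), pd μ ((interior diamond).indicator f) y = pd μ f y :=
        fun μ f => by rw [pd, pd, (hev f).fderiv_eq]
      have hd : ∀ {f : Spacetime → W}, ContDiffOn ℝ 1 f (interior diamond) →
          DifferentiableAt ℝ f y := fun hf => (hf.contDiffAt hn).differentiableAt one_ne_zero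
      obtain ⟨c1, c2, c3⟩ := hC y hy
      have := weighted_energy_balance (lam := lam) hη (abs_nonneg C) le_rfl (fun j => hd (ha j))
        (fun j => hd (hE j)) (fun j k => hd (hH j k)) (hanti y hyΩ)
        (fun j => (c1 j).trans (hC' y)) (fun k => (c2 k).trans (hC' y))
        (fun j k => (c3 j k).trans (hC' y))
      simp only [hX, hY, hpd]
      rw [indicator_of_mem hyΩ]
      linarith
    · have hn := hK.isClosed.isOpen_compl.mem_nhds hy
      have hpd : ∀ μ (f : Spacetime → ℝ), (∀ w ∉ K, f w = 0) → pd μ f y = 0 := by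
        intro μ f hf
        have : f =ᶠ[𝓝 y] fun _ => 0 := Filter.eventuallyEq_of_mem hn fun w hw => hf w hw
        rw [pd, this.fderiv_eq]
        simp
      simp [hX0 y hy, hpd _ _ hX0, fun j => hpd (Fin.succ j) _ (hY0 j)]
  have hXle : ∫ y, X y ≤ 0 := by
    have hsum : Integrable fun y => ∑ j : Fin 3, pd j.succ (Y j) y :=
      integrable_finsetSum _ fun j _ => hint (hYc j) (hYs j) _
    refine (integral_mono (hXc.continuous.integrable_of_hasCompactSupport hXs)
      ((hint hXc hXs 0).sub hsum).neg hle).trans ?_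
    simp only [Pi.neg_apply, Pi.sub_apply]
    rw [integral_neg, integral_sub (hint hXc hXs 0) hsum,
      integral_finsetSum _ fun j _ => hint (hYc j) (hYs j) _, hzero hXc hXs]
    simp [fun j => hzero (hYc j) (hYs j)]
  have hXnn : ∀ y, 0 ≤ X y := fun y =>
    indicator_nonneg (fun y _ => mul_nonneg (cutoff_nonneg _ _ _) (energy_nonneg _ _ _)) y
  have hXz : X z = 0 := by
    by_contra hne
    exact absurd hXle (not_le.2
      (hXc.continuous.integral_pos_of_hasCompactSupport_nonneg_nonzero hXs hXnn hne))
  rw [hX, indicator_of_mem hz] at hXz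
  exact eq_zero_of_energy_eq_zero
    ((mul_eq_zero.1 hXz).resolve_left (cutoff_pos hηz).ne') j

end Uniqueness

/-! ### Passage from inner product spaces to finite-dimensional normed spaces -/

section FiniteDimensional

variable {W : Type*} [NormedAddCommGroup W]

theorem norm_le_size_fst (a E : Fin 3 → W) (H : Fin 3 → Fin 3 → W) (j : Fin 3) :
    ‖a j‖ ≤ size a E H := by
  have h1 : ‖a j‖ ≤ ∑ j, ‖a j‖ :=
    Finset.single_le_sum (f := fun j => ‖a j‖) (fun _ _ => norm_nonneg _) (Finset.mem_univ j)
  have h2 : 0 ≤ ∑ j, ‖E j‖ := by positivity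
  have h3 : 0 ≤ ∑ j, ∑ k, ‖H j k‖ := by positivity
  unfold size
  linarith

theorem norm_le_size_snd (a E : Fin 3 → W) (H : Fin 3 → Fin 3 → W) (j : Fin 3) :
    ‖E j‖ ≤ size a E H := by
  have h1 : ‖E j‖ ≤ ∑ j, ‖E j‖ :=
    Finset.single_le_sum (f := fun j => ‖E j‖) (fun _ _ => norm_nonneg _) (Finset.mem_univ j)
  have h2 : 0 ≤ ∑ j, ‖a j‖ := by positivity
  have h3 : 0 ≤ ∑ j, ∑ k, ‖H j k‖ := by positivity
  unfold size
  linarith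

theorem norm_le_size_trd (a E : Fin 3 → W) (H : Fin 3 → Fin 3 → W) (j k : Fin 3) :
    ‖H j k‖ ≤ size a E H := by
  have h1 : ‖H j k‖ ≤ ∑ k, ‖H j k‖ :=
    Finset.single_le_sum (f := fun k => ‖H j k‖) (fun _ _ => norm_nonneg _) (Finset.mem_univ k)
  have h4 : ∑ k, ‖H j k‖ ≤ ∑ j, ∑ k, ‖H j k‖ :=
    Finset.single_le_sum (f := fun j => ∑ k, ‖H j k‖) (fun _ _ => by positivity)
      (Finset.mem_univ j)
  have h2 : 0 ≤ ∑ j, ‖a j‖ := by positivity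
  have h3 : 0 ≤ ∑ j, ‖E j‖ := by positivity
  unfold size
  linarith

variable [NormedSpace ℝ W]

theorem pd_equiv {W' : Type*} [NormedAddCommGroup W'] [NormedSpace ℝ W'] (L : W ≃L[ℝ] W')
    (μ : Fin 4) (f : Spacetime → W) (z : Spacetime) :
    pd μ (fun y => L (f y)) z = L (pd μ f z) := by
  have := L.comp_fderiv (f := f) (x := z)
  rw [pd, pd, show (fun y => L (f y)) = L ∘ f from rfl, this]
  rfl

/-- `eq_zero_of_energy_estimate` for fields valued in a finite-dimensional normed space. -/
theorem eq_zero_of_energy_estimate_of_finiteDimensional [FiniteDimensional ℝ W]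
    {a E : Fin 3 → Spacetime → W} {H : Fin 3 → Fin 3 → Spacetime → W}
    (ha : ∀ j, ContDiffOn ℝ 1 (a j) (interior diamond))
    (hE : ∀ j, ContDiffOn ℝ 1 (E j) (interior diamond))
    (hH : ∀ j k, ContDiffOn ℝ 1 (H j k) (interior diamond))
    (hanti : ∀ z ∈ interior diamond, ∀ j k, H j k z = -H k j z)
    {M : Set Spacetime} (hM : IsOpen M) (hMl : lowerBdry ⊆ M)
    (h0 : ∀ z ∈ M ∩ interior diamond,
      (∀ j, a j z = 0) ∧ (∀ j, E j z = 0) ∧ ∀ j k, H j k z = 0)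
    (hest : ∀ K ⊆ interior diamond, IsCompact K → ∃ C : ℝ, ∀ z ∈ K,
      (∀ j, ‖pd 0 (a j) z‖ ≤ C * size (a · z) (E · z) (H · · z)) ∧
      (∀ k, ‖pd 0 (E k) z - ∑ j : Fin 3, pd j.succ (H j k) z‖ ≤
        C * size (a · z) (E · z) (H · · z)) ∧
      (∀ j k, ‖pd 0 (H j k) z - (pd j.succ (E k) z - pd k.succ (E j) z)‖ ≤
        C * size (a · z) (E · z) (H · · z)))
    {z : Spacetime} (hz : z ∈ interior diamond) (j : Fin 3) : a j z = 0 := by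
  set L := toEuclidean (E := W)
  set L' : EuclideanSpace ℝ (Fin (Module.finrank ℝ W)) →L[ℝ] W := L.symm.toContinuousLinearMap
  have hL : ∀ {f : Spacetime → W}, ContDiffOn ℝ 1 f (interior diamond) →
      ContDiffOn ℝ 1 (fun y => L (f y)) (interior diamond) :=
    fun hf => L.contDiff.comp_contDiffOn hf
  have hinv : ∀ w : W, ‖w‖ ≤ ‖L'‖ * ‖L w‖ := fun w => by
    simpa [L'] using L'.le_opNorm (L w)
  have hsize : ∀ y, size (a · y) (E · y) (H · · y) ≤ ‖L'‖ *
      size (fun j => L (a j y)) (fun j => L (E j y)) (fun j k => L (H j k y)) := fun y => by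
    unfold size
    simp only [mul_add, Finset.mul_sum]
    gcongr <;> apply hinv
  have hLle : ∀ {r : W} {C : ℝ} (y : Spacetime), ‖r‖ ≤ C * size (a · y) (E · y) (H · · y) →
      ‖L r‖ ≤ ‖L.toContinuousLinearMap‖ * (|C| * ‖L'‖) *
        size (fun j => L (a j y)) (fun j => L (E j y)) (fun j k => L (H j k y)) := by
    intro r C y hr
    have h1 : ‖L r‖ ≤ ‖L.toContinuousLinearMap‖ * ‖r‖ := L.toContinuousLinearMap.le_opNorm r
    have h2 : ‖r‖ ≤ |C| * size (a · y) (E · y) (H · · y) :=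
      hr.trans (mul_le_mul_of_nonneg_right (le_abs_self C) (size_nonneg _ _ _))
    calc ‖L r‖ ≤ ‖L.toContinuousLinearMap‖ * (|C| * (‖L'‖ *
          size (fun j => L (a j y)) (fun j => L (E j y)) (fun j k => L (H j k y)))) := by
          refine h1.trans (mul_le_mul_of_nonneg_left (h2.trans ?_) (norm_nonneg _))
          exact mul_le_mul_of_nonneg_left (hsize y) (abs_nonneg C)
      _ = _ := by ring
  have key := eq_zero_of_energy_estimate (a := fun j y => L (a j y)) (E := fun j y => L (E j y))
    (H := fun j k y => L (H j k y)) (fun j => hL (ha j)) (fun j => hL (hE j))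
    (fun j k => hL (hH j k)) (fun y hy j k => by simp only [hanti y hy j k, map_neg])
    hM hMl (fun y hy => by
      obtain ⟨h1, h2, h3⟩ := h0 y hy
      simp [h1, h2, h3])
    (fun K hK hKc => by
      obtain ⟨C, hC⟩ := hest K hK hKc
      refine ⟨‖L.toContinuousLinearMap‖ * (|C| * ‖L'‖), fun y hy => ?_⟩
      obtain ⟨h1, h2, h3⟩ := hC y hy
      refine ⟨fun j => ?_, fun k => ?_, fun j k => ?_⟩
      · simpa only [pd_equiv] using hLle y (h1 j)
      · simpa only [pd_equiv, map_sub, map_sum] using hLle y (h2 k)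
      · simpa only [pd_equiv, map_sub] using hLle y (h3 j k)) hz j
  simpa using key

end FiniteDimensional

/-! ### The Yang–Mills equations in components -/

section Components

variable {𝔸 : Type*} [NormedRing 𝔸] [NormedAlgebra ℝ 𝔸]

/-- The components `F_{μν}` of the curvature. -/
def curvComp (A : Fin 4 → Spacetime → 𝔸) (μ ν : Fin 4) (z : Spacetime) : 𝔸 :=
  pd μ (A ν) z - pd ν (A μ) z + (A μ z * A ν z - A ν z * A μ z)

/-- The component `∇^μ F_{μν}` of the covariant divergence of the curvature. -/
def divComp (A : Fin 4 → Spacetime → 𝔸) (ν : Fin 4) (z : Spacetime) : 𝔸 :=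
  ∑ μ, g μ • (pd μ (curvComp A μ ν) z + (A μ z * curvComp A μ ν z - curvComp A μ ν z * A μ z))

theorem curvComp_antisymm (A : Fin 4 → Spacetime → 𝔸) (μ ν : Fin 4) (z : Spacetime) :
    curvComp A μ ν z = -curvComp A ν μ z := by
  unfold curvComp; abel

variable {F : Type*} [NormedAddCommGroup F] [NormedSpace ℝ F] {Ω : Set Spacetime}

theorem contDiffOn_pd (hΩ : IsOpen Ω) {f : Spacetime → F} {m n : WithTop ℕ∞}
    (hf : ContDiffOn ℝ n f Ω) (hmn : m + 1 ≤ n) (μ : Fin 4) : ContDiffOn ℝ m (pd μ f) Ω :=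
  (hf.fderiv_of_isOpen hΩ hmn).clm_apply contDiffOn_const

theorem contDiffOn_curvComp (hΩ : IsOpen Ω) {A : Fin 4 → Spacetime → 𝔸} {m n : WithTop ℕ∞}
    (hA : ∀ μ, ContDiffOn ℝ n (A μ) Ω) (hmn : m + 1 ≤ n) (μ ν : Fin 4) :
    ContDiffOn ℝ m (curvComp A μ ν) Ω := by
  have h : ∀ μ, ContDiffOn ℝ m (A μ) Ω := fun μ => (hA μ).of_le (le_self_add.trans hmn)
  exact ((contDiffOn_pd hΩ (hA ν) hmn μ).sub (contDiffOn_pd hΩ (hA μ) hmn ν)).add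
    (((h μ).mul (h ν)).sub ((h ν).mul (h μ)))

theorem pd_congr (hΩ : IsOpen Ω) {f h : Spacetime → F} (hfh : EqOn f h Ω) (μ : Fin 4) :
    EqOn (pd μ f) (pd μ h) Ω := fun z hz => by
  rw [pd, pd, (hfh.eventuallyEq_of_mem (hΩ.mem_nhds hz)).fderiv_eq]

theorem pd_const (c : F) (μ : Fin 4) (z : Spacetime) : pd μ (fun _ => c) z = 0 := by
  simp [pd]

theorem curvComp_congr (hΩ : IsOpen Ω) {A B : Fin 4 → Spacetime → 𝔸}
    (h : ∀ μ, EqOn (A μ) (B μ) Ω) (μ ν : Fin 4) : EqOn (curvComp A μ ν) (curvComp B μ ν) Ω := by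
  intro z hz
  rw [curvComp, curvComp, pd_congr hΩ (h ν) μ hz, pd_congr hΩ (h μ) ν hz, h μ hz, h ν hz]

theorem pd_add {f h : Spacetime → F} {z : Spacetime} (μ : Fin 4) (hf : DifferentiableAt ℝ f z)
    (hh : DifferentiableAt ℝ h z) : pd μ (fun y => f y + h y) z = pd μ f z + pd μ h z := by
  simp only [pd]
  rw [fderiv_fun_add hf hh]
  rfl

theorem pd_sub {f h : Spacetime → F} {z : Spacetime} (μ : Fin 4) (hf : DifferentiableAt ℝ f z)
    (hh : DifferentiableAt ℝ h z) : pd μ (fun y => f y - h y) z = pd μ f z - pd μ h z := by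
  simp only [pd]
  rw [fderiv_fun_sub hf hh]
  rfl

theorem pd_mul' {f h : Spacetime → 𝔸} {z : Spacetime} (μ : Fin 4) (hf : DifferentiableAt ℝ f z)
    (hh : DifferentiableAt ℝ h z) :
    pd μ (fun y => f y * h y) z = pd μ f z * h z + f z * pd μ h z := by
  simp only [pd]
  rw [fderiv_fun_mul' hf hh]
  simp [add_comm]

theorem pd_comm {f : Spacetime → F} {z : Spacetime} (hf : ContDiffAt ℝ 2 f z) (μ ν : Fin 4) :
    pd μ (pd ν f) z = pd ν (pd μ f) z := by
  have hs : IsSymmSndFDerivAt ℝ f z := hf.isSymmSndFDerivAt (by simp)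
  have hd : DifferentiableAt ℝ (fderiv ℝ f) z :=
    (hf.fderiv_right (m := 1) (by norm_num)).differentiableAt one_ne_zero
  have h : ∀ μ ν, pd μ (pd ν f) z = fderiv ℝ (fderiv ℝ f) z (e μ) (e ν) := fun μ ν => by
    have := (hd.hasFDerivAt.clm_apply (hasFDerivAt_const (e ν) z)).fderiv
    unfold pd
    rw [this]
    simp
  rw [h, h, hs.eq]

end Components

/-! ### Evolution equations in temporal gauge and uniqueness -/

section Components

variable {𝔸 : Type*} [NormedRing 𝔸] [NormedAlgebra ℝ 𝔸] {Ω : Set Spacetime}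

theorem curvComp_zero_of_temporal (hΩ : IsOpen Ω) {A : Fin 4 → Spacetime → 𝔸}
    (hA0 : ∀ z ∈ Ω, A 0 z = 0) (ν : Fin 4) : EqOn (curvComp A 0 ν) (pd 0 (A ν)) Ω := by
  intro z hz
  have h : EqOn (A 0) (fun _ => 0) Ω := hA0
  rw [curvComp, pd_congr hΩ h ν hz, pd_const, hA0 z hz]
  simp

/-- In temporal gauge, `∂ₜ F_{jk} = ∂_j F_{0k} - ∂_k F_{0j} + [F_{0j}, A_k] + [A_j, F_{0k}]`. -/
theorem pd_zero_curvComp_of_temporal (hΩ : IsOpen Ω) {A : Fin 4 → Spacetime → 𝔸}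
    (hA : ∀ μ, ContDiffOn ℝ 2 (A μ) Ω) (hA0 : ∀ z ∈ Ω, A 0 z = 0) (μ ν : Fin 4) {z : Spacetime}
    (hz : z ∈ Ω) :
    pd 0 (curvComp A μ ν) z = pd μ (curvComp A 0 ν) z - pd ν (curvComp A 0 μ) z +
      ((curvComp A 0 μ z * A ν z - A ν z * curvComp A 0 μ z) +
        (A μ z * curvComp A 0 ν z - curvComp A 0 ν z * A μ z)) := by
  have hn := hΩ.mem_nhds hz
  have hc : ∀ μ, ContDiffAt ℝ 2 (A μ) z := fun μ => (hA μ).contDiffAt hn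
  have hd : ∀ μ, DifferentiableAt ℝ (A μ) z := fun μ => (hc μ).differentiableAt two_ne_zero
  have hp : ∀ μ ν, DifferentiableAt ℝ (pd μ (A ν)) z := fun μ ν =>
    ((contDiffOn_pd hΩ (m := 1) (hA ν) (by norm_num) μ).contDiffAt hn).differentiableAt one_ne_zero
  have h0 := curvComp_zero_of_temporal hΩ hA0
  rw [pd_congr hΩ (h0 ν) μ hz, pd_congr hΩ (h0 μ) ν hz, h0 μ hz, h0 ν hz,
    ← pd_comm (hc ν) 0 μ, ← pd_comm (hc μ) 0 ν]
  unfold curvComp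
  rw [pd_add 0 ((hp μ ν).fun_sub (hp ν μ)) (((hd μ).fun_mul (hd ν)).fun_sub ((hd ν).fun_mul (hd μ))),
    pd_sub 0 (hp μ ν) (hp ν μ), pd_sub 0 ((hd μ).fun_mul (hd ν)) ((hd ν).fun_mul (hd μ)),
    pd_mul' 0 (hd μ) (hd ν), pd_mul' 0 (hd ν) (hd μ)]
  abel

theorem divComp_of_temporal {A : Fin 4 → Spacetime → 𝔸} {z : Spacetime}
    (hA0 : A 0 z = 0) (ν : Fin 4) :
    divComp A ν z = -pd 0 (curvComp A 0 ν) z + ∑ j : Fin 3, (pd j.succ (curvComp A j.succ ν) z +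
      (A j.succ z * curvComp A j.succ ν z - curvComp A j.succ ν z * A j.succ z)) := by
  rw [divComp, Fin.sum_univ_succ]
  simp [g, hA0]

/-- The difference telescopes into four products, each with one small factor. The other factor is
always `y` or `x'`, so no bound on `x` or `y'` is required. -/
theorem norm_commutator_sub_le {𝔸 : Type*} [NormedRing 𝔸] {x y x' y' : 𝔸} {R S : ℝ} (hy : ‖y‖ ≤ R)
    (hx' : ‖x'‖ ≤ R) (h1 : ‖x - x'‖ ≤ S) (h2 : ‖y - y'‖ ≤ S) :
    ‖(x * y - y * x) - (x' * y' - y' * x')‖ ≤ 4 * R * S := by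
  have hS : 0 ≤ S := (norm_nonneg _).trans h1
  have hR : 0 ≤ R := (norm_nonneg _).trans hy
  have e : (x * y - y * x) - (x' * y' - y' * x') =
      (x - x') * y + x' * (y - y') - (y * (x - x') + (y - y') * x') := by noncomm_ring
  have m1 : ‖(x - x') * y‖ ≤ S * R := (norm_mul_le _ _).trans (by gcongr)
  have m2 : ‖x' * (y - y')‖ ≤ R * S := (norm_mul_le _ _).trans (by gcongr)
  have m3 : ‖y * (x - x')‖ ≤ R * S := (norm_mul_le _ _).trans (by gcongr)
  have m4 : ‖(y - y') * x'‖ ≤ S * R := (norm_mul_le _ _).trans (by gcongr)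
  rw [e]
  linarith [norm_sub_le ((x - x') * y + x' * (y - y')) (y * (x - x') + (y - y') * x'),
    norm_add_le ((x - x') * y) (x' * (y - y')), norm_add_le (y * (x - x')) ((y - y') * x')]

/-- Two connections in temporal gauge that agree near the lower boundary of the diamond, and whose
curvatures have the same spatial divergence, agree. -/
theorem eqOn_of_divComp_eq [FiniteDimensional ℝ 𝔸] {A B : Fin 4 → Spacetime → 𝔸}
    (hA : ∀ μ, ContDiffOn ℝ 2 (A μ) (interior diamond))
    (hB : ∀ μ, ContDiffOn ℝ 2 (B μ) (interior diamond))
    (hA0 : ∀ z ∈ interior diamond, A 0 z = 0) (hB0 : ∀ z ∈ interior diamond, B 0 z = 0)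
    {M : Set Spacetime} (hM : IsOpen M) (hMl : lowerBdry ⊆ M)
    (hAB : ∀ μ, EqOn (A μ) (B μ) (M ∩ interior diamond))
    (hdiv : ∀ k : Fin 3, EqOn (divComp A k.succ) (divComp B k.succ) (interior diamond))
    (μ : Fin 4) : EqOn (A μ) (B μ) (interior diamond) := by
  have hΩ : IsOpen (interior diamond) := isOpen_interior
  have hFA : ∀ μ ν, ContDiffOn ℝ 1 (curvComp A μ ν) (interior diamond) :=
    contDiffOn_curvComp hΩ hA (by norm_num)
  have hFB : ∀ μ ν, ContDiffOn ℝ 1 (curvComp B μ ν) (interior diamond) :=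
    contDiffOn_curvComp hΩ hB (by norm_num)
  have hd : ∀ {f : Spacetime → 𝔸} {z}, z ∈ interior diamond →
      ContDiffOn ℝ 1 f (interior diamond) → DifferentiableAt ℝ f z := fun hz hf =>
    (hf.contDiffAt (hΩ.mem_nhds hz)).differentiableAt one_ne_zero
  have hA1 : ∀ μ, ContDiffOn ℝ 1 (A μ) (interior diamond) := fun μ =>
    (hA μ).of_le (by norm_num)
  have hB1 : ∀ μ, ContDiffOn ℝ 1 (B μ) (interior diamond) := fun μ =>
    (hB μ).of_le (by norm_num)
  have hsub : ∀ {f h : Spacetime → 𝔸}, ContDiffOn ℝ 1 f (interior diamond) →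
      ContDiffOn ℝ 1 h (interior diamond) → ∀ μ, ∀ z ∈ interior diamond,
      pd μ (fun y => f y - h y) z = pd μ f z - pd μ h z := fun hf hh μ z hz =>
    pd_sub μ (hd hz hf) (hd hz hh)
  set a : Fin 3 → Spacetime → 𝔸 := fun j y => A j.succ y - B j.succ y with ha
  set E : Fin 3 → Spacetime → 𝔸 := fun k y => curvComp A 0 k.succ y - curvComp B 0 k.succ y with hE
  set H : Fin 3 → Fin 3 → Spacetime → 𝔸 := fun j k y =>
    curvComp A j.succ k.succ y - curvComp B j.succ k.succ y with hH
  -- Temporal gauge closes the system: `F_{0j} = ∂ₜA_j`, so the potentials can be estimated along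
  -- with the curvatures, which handles the undifferentiated potentials in the commutators.
  have hpa : ∀ z ∈ interior diamond, ∀ j, pd 0 (a j) z = E j z := fun z hz j => by
    rw [ha, hsub (hA1 _) (hB1 _) 0 z hz]
    simp only [hE]
    rw [curvComp_zero_of_temporal hΩ hA0 _ hz, curvComp_zero_of_temporal hΩ hB0 _ hz]
  have hpE : ∀ z ∈ interior diamond, ∀ k, pd 0 (E k) z - ∑ j : Fin 3, pd j.succ (H j k) z =
      ∑ j : Fin 3, ((A j.succ z * curvComp A j.succ k.succ z -
          curvComp A j.succ k.succ z * A j.succ z) -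
        (B j.succ z * curvComp B j.succ k.succ z -
          curvComp B j.succ k.succ z * B j.succ z)) := fun z hz k => by
    have h1 := hdiv k hz
    rw [divComp_of_temporal (hA0 z hz), divComp_of_temporal (hB0 z hz)] at h1
    simp only [Finset.sum_add_distrib] at h1
    simp only [hE, hH, hsub (hFA _ _) (hFB _ _) _ z hz]
    rw [Finset.sum_sub_distrib, Finset.sum_sub_distrib]
    linear_combination (norm := module) (-1 : ℝ) • h1
  have hpH : ∀ z ∈ interior diamond, ∀ j k,
      pd 0 (H j k) z - (pd j.succ (E k) z - pd k.succ (E j) z) =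
      ((A j.succ z * curvComp A 0 k.succ z - curvComp A 0 k.succ z * A j.succ z) -
        (B j.succ z * curvComp B 0 k.succ z - curvComp B 0 k.succ z * B j.succ z)) -
      ((A k.succ z * curvComp A 0 j.succ z - curvComp A 0 j.succ z * A k.succ z) -
        (B k.succ z * curvComp B 0 j.succ z - curvComp B 0 j.succ z * B k.succ z)) := by
    intro z hz j k
    simp only [hE, hH, hsub (hFA _ _) (hFB _ _) _ z hz]
    rw [pd_zero_curvComp_of_temporal hΩ hA hA0 _ _ hz,
      pd_zero_curvComp_of_temporal hΩ hB hB0 _ _ hz]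
    abel
  have key : ∀ z ∈ interior diamond, ∀ j, a j z = 0 := fun z hz j => by
    refine eq_zero_of_energy_estimate_of_finiteDimensional (a := a) (E := E) (H := H)
      (fun j => (hA1 _).sub (hB1 _)) (fun j => (hFA _ _).sub (hFB _ _))
      (fun j k => (hFA _ _).sub (hFB _ _)) (fun z _ j k => ?_) hM hMl (fun z hz => ?_)
      (fun K hK hKc => ?_) hz j
    · simp only [hH]
      rw [curvComp_antisymm A, curvComp_antisymm B]
      abel
    · have := curvComp_congr (hM.inter hΩ) hAB
      simp only [ha, hE, hH]
      exact ⟨fun j => sub_eq_zero.2 (hAB _ hz), fun j => sub_eq_zero.2 (this _ _ hz),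
        fun j k => sub_eq_zero.2 (this _ _ hz)⟩
    · obtain ⟨R, hR⟩ := hKc.exists_bound_of_continuousOn (f := fun y =>
        (fun μ => B μ y, fun μ ν => curvComp A μ ν y)) (ContinuousOn.prodMk
          (continuousOn_pi.2 fun μ => (hB1 μ).continuousOn.mono hK)
          (continuousOn_pi.2 fun μ => continuousOn_pi.2 fun ν =>
            (hFA μ ν).continuousOn.mono hK))
      have hRB : ∀ y ∈ K, ∀ μ, ‖B μ y‖ ≤ R := fun y hy μ =>
        (norm_le_pi_norm (fun μ => B μ y) μ).trans ((le_max_left _ _).trans (hR y hy))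
      have hRF : ∀ y ∈ K, ∀ μ ν, ‖curvComp A μ ν y‖ ≤ R := fun y hy μ ν =>
        (norm_le_pi_norm (fun ν => curvComp A μ ν y) ν).trans
          ((norm_le_pi_norm (fun μ ν => curvComp A μ ν y) μ).trans
            ((le_max_right _ _).trans (hR y hy)))
      -- The equation for `E` has three commutator differences of size `4 R S`, that for `H` has
      -- two, and that for `a` contributes the `1`.
      refine ⟨1 + 12 * R, fun y hy => ?_⟩
      have hyΩ := hK hy
      have hR0 : 0 ≤ R := (norm_nonneg _).trans (hRB y hy 0)
      set S := size (a · y) (E · y) (H · · y)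
      have hS0 : 0 ≤ S := size_nonneg _ _ _
      have sa : ∀ j, ‖A (Fin.succ j) y - B j.succ y‖ ≤ S := fun j =>
        norm_le_size_fst (a · y) (E · y) (H · · y) j
      have sE : ∀ j : Fin 3, ‖curvComp A 0 j.succ y - curvComp B 0 j.succ y‖ ≤ S := fun j =>
        norm_le_size_snd (a · y) (E · y) (H · · y) j
      have sH : ∀ j k : Fin 3,
          ‖curvComp A j.succ k.succ y - curvComp B j.succ k.succ y‖ ≤ S := fun j k =>
        norm_le_size_trd (a · y) (E · y) (H · · y) j k
      have hRS : 0 ≤ R * S := mul_nonneg hR0 hS0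
      refine ⟨fun j => ?_, fun k => ?_, fun j k => ?_⟩
      · rw [hpa y hyΩ]
        have := sE j
        simp only [hE]
        linarith
      · rw [hpE y hyΩ]
        refine (norm_sum_le _ _).trans ?_
        refine (Finset.sum_le_sum fun j _ => norm_commutator_sub_le (hRF y hy _ _) (hRB y hy _)
          (sa j) (sH j k)).trans ?_
        simp only [Finset.sum_const, Finset.card_univ, Fintype.card_fin, nsmul_eq_mul]
        push_cast
        linarith
      · rw [hpH y hyΩ]
        refine (norm_sub_le _ _).trans ?_
        have h1 := norm_commutator_sub_le (hRF y hy 0 k.succ) (hRB y hy j.succ) (sa j) (sE k)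
        have h2 := norm_commutator_sub_le (hRF y hy 0 j.succ) (hRB y hy k.succ) (sa k) (sE j)
        linarith
  intro z hz
  refine Fin.cases ?_ (fun j => ?_) μ
  · rw [hA0 z hz, hB0 z hz]
  · exact sub_eq_zero.1 (key z hz j)

end Components

/-! ### Gauge covariance -/

section Gauge

variable {𝔸 : Type*} [NormedRing 𝔸] [NormedAlgebra ℝ 𝔸] {Ω : Set Spacetime}

/-- Differentiate the gauge relation `V A = ∂V + B V` and antisymmetrize: the second derivatives of
`V` cancel. Keeping the relation in this multiplied form avoids differentiating `V⁻¹`. -/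
theorem mul_curvComp_of_gauge (hΩ : IsOpen Ω) {A B : Fin 4 → Spacetime → 𝔸} {V : Spacetime → 𝔸}
    (hA : ∀ μ, ContDiffOn ℝ 2 (A μ) Ω) (hB : ∀ μ, ContDiffOn ℝ 2 (B μ) Ω)
    (hV : ContDiffOn ℝ 2 V Ω)
    (h : ∀ μ, ∀ z ∈ Ω, V z * A μ z = pd μ V z + B μ z * V z) (μ ν : Fin 4) :
    ∀ z ∈ Ω, V z * curvComp A μ ν z = curvComp B μ ν z * V z := by
  intro z hz
  have hn := hΩ.mem_nhds hz
  have hdA : ∀ μ, DifferentiableAt ℝ (A μ) z := fun μ =>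
    ((hA μ).contDiffAt hn).differentiableAt two_ne_zero
  have hdB : ∀ μ, DifferentiableAt ℝ (B μ) z := fun μ =>
    ((hB μ).contDiffAt hn).differentiableAt two_ne_zero
  have hdV : DifferentiableAt ℝ V z := (hV.contDiffAt hn).differentiableAt two_ne_zero
  have hdV' : ∀ μ, DifferentiableAt ℝ (pd μ V) z := fun μ =>
    ((contDiffOn_pd hΩ (m := 1) hV (by norm_num) μ).contDiffAt hn).differentiableAt one_ne_zero
  have key : ∀ μ ν, V z * pd μ (A ν) z =
      pd μ (pd ν V) z + (pd μ (B ν) z * V z + B ν z * pd μ V z) - pd μ V z * A ν z := by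
    intro μ ν
    have h1 := pd_congr hΩ (f := fun y => V y * A ν y) (h := fun y => pd ν V y + B ν y * V y)
      (h ν) μ hz
    rw [pd_mul' μ hdV (hdA ν), pd_add μ (hdV' ν) ((hdB ν).fun_mul hdV),
      pd_mul' μ (hdB ν) hdV] at h1
    rw [← h1]
    abel
  unfold curvComp
  have e : V z * (pd μ (A ν) z - pd ν (A μ) z + (A μ z * A ν z - A ν z * A μ z)) =
      V z * pd μ (A ν) z - V z * pd ν (A μ) z + (V z * A μ z * A ν z - V z * A ν z * A μ z) := by
    noncomm_ring
  have e1 : B μ z * V z * A ν z = B μ z * (pd ν V z + B ν z * V z) := by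
    rw [mul_assoc, h ν z hz]
  have e2 : B ν z * V z * A μ z = B ν z * (pd μ V z + B μ z * V z) := by
    rw [mul_assoc, h μ z hz]
  rw [e, key μ ν, key ν μ, h μ z hz, h ν z hz, pd_comm (hV.contDiffAt hn) ν μ, add_mul (pd μ V z),
    add_mul (pd ν V z), e1, e2]
  noncomm_ring

/-- Covariance of the curvature is differentiated once more; the terms in `∂V` cancel against those
from the commutators. -/
theorem mul_divComp_of_gauge (hΩ : IsOpen Ω) {A B : Fin 4 → Spacetime → 𝔸} {V : Spacetime → 𝔸}
    (hA : ∀ μ, ContDiffOn ℝ 2 (A μ) Ω) (hB : ∀ μ, ContDiffOn ℝ 2 (B μ) Ω)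
    (hV : ContDiffOn ℝ 2 V Ω)
    (h : ∀ μ, ∀ z ∈ Ω, V z * A μ z = pd μ V z + B μ z * V z) (ν : Fin 4) :
    ∀ z ∈ Ω, V z * divComp A ν z = divComp B ν z * V z := by
  intro z hz
  have hn := hΩ.mem_nhds hz
  have hF := mul_curvComp_of_gauge hΩ hA hB hV h
  have hdA : ∀ μ ν, DifferentiableAt ℝ (curvComp A μ ν) z := fun μ ν =>
    ((contDiffOn_curvComp hΩ (m := 1) hA (by norm_num) μ ν).contDiffAt hn).differentiableAt
      one_ne_zero
  have hdB : ∀ μ ν, DifferentiableAt ℝ (curvComp B μ ν) z := fun μ ν =>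
    ((contDiffOn_curvComp hΩ (m := 1) hB (by norm_num) μ ν).contDiffAt hn).differentiableAt
      one_ne_zero
  have hdV : DifferentiableAt ℝ V z := (hV.contDiffAt hn).differentiableAt two_ne_zero
  rw [divComp, divComp, Finset.mul_sum, Finset.sum_mul]
  refine Finset.sum_congr rfl fun μ _ => ?_
  rw [mul_smul_comm, smul_mul_assoc]
  congr 1
  have h1 := pd_congr hΩ (f := fun y => V y * curvComp A μ ν y)
    (h := fun y => curvComp B μ ν y * V y) (hF μ ν) μ hz
  rw [pd_mul' μ hdV (hdA μ ν), pd_mul' μ (hdB μ ν) hdV] at h1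
  have h2 : V z * pd μ (curvComp A μ ν) z = pd μ (curvComp B μ ν) z * V z +
      curvComp B μ ν z * pd μ V z - pd μ V z * curvComp A μ ν z := by
    rw [← h1]; abel
  have e1 : B μ z * V z * curvComp A μ ν z = B μ z * (curvComp B μ ν z * V z) := by
    rw [mul_assoc, hF μ ν z hz]
  have e2 : curvComp B μ ν z * V z * A μ z = curvComp B μ ν z * (pd μ V z + B μ z * V z) := by
    rw [mul_assoc, h μ z hz]
  rw [mul_add, mul_sub, ← mul_assoc, ← mul_assoc, h2, h μ z hz, hF μ ν z hz, add_mul (pd μ V z),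
    e1, e2]
  noncomm_ring

end Gauge

/-! ### The components of the source -/

section Smoothness

variable {E F : Type*} [NormedAddCommGroup E] [NormedSpace ℝ E] [NormedAddCommGroup F]
  [NormedSpace ℝ F] {k l : ℕ} {m m' : WithTop ℕ∞}

/-- The algebraic operations on forms are linear or bilinear in finitely many continuous arguments.
Hence `⋆F_A` loses only the derivative taken in `F_A` and can itself be differentiated. -/
theorem contDiff_smulRight (f : E [⋀^Fin k]→L[ℝ] ℝ) : ContDiff ℝ m fun w : F => f.smulRight w := by
  let L : F →L[ℝ] E [⋀^Fin k]→L[ℝ] F :=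
    ((ContinuousLinearMap.compContinuousAlternatingMapCLM ℝ E ℝ F (ι := Fin k)).flip f).comp
      (ContinuousLinearMap.smulRightL ℝ ℝ F (ContinuousLinearMap.id ℝ ℝ))
  have : (fun w : F => f.smulRight w) = L := by
    funext w
    ext v
    rfl
  rw [this]
  exact L.contDiff

theorem contDiff_sum_smulRight {ι : Type*} [Fintype ι] (c : ℝ) (d : ι → ℝ)
    (f : ι → E [⋀^Fin l]→L[ℝ] ℝ) (v : ι → Fin k → E) :
    ContDiff ℝ m fun η : E [⋀^Fin k]→L[ℝ] F => c • ∑ i, d i • (f i).smulRight (η (v i)) :=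
  ContDiff.const_smul _ (ContDiff.sum fun i _ => ContDiff.const_smul _
    ((contDiff_smulRight (f i)).comp (ContinuousAlternatingMap.apply ℝ E F (v i)).contDiff))

theorem contDiff_ofSubsingleton : ContDiff ℝ m fun a : E →L[ℝ] F =>
    ContinuousAlternatingMap.ofSubsingleton ℝ E F (0 : Fin 1) a :=
  (ContinuousAlternatingMap.ofSubsingletonLIE (𝕜 := ℝ) (E := E) (F := F) (0 : Fin 1)).contDiff

theorem contDiff_alternatizeUncurryFin : ContDiff ℝ m fun f : E →L[ℝ] E [⋀^Fin k]→L[ℝ] F =>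
    ContinuousAlternatingMap.alternatizeUncurryFin f := by
  have h := ContinuousLinearMap.contDiff (𝕜 := ℝ) (E := E →L[ℝ] E [⋀^Fin k]→L[ℝ] F)
    (F := E [⋀^Fin (k + 1)]→L[ℝ] F) (n := m)
    (ContinuousAlternatingMap.alternatizeUncurryFinCLM (n := k) ℝ E F)
  exact h

theorem contDiff_alternatize_bilinear (b : F →L[ℝ] F →L[ℝ] F) :
    ContDiff ℝ m fun p : (E →L[ℝ] F) × (E [⋀^Fin k]→L[ℝ] F) =>
      ContinuousAlternatingMap.alternatizeUncurryFin
        (((ContinuousLinearMap.compContinuousAlternatingMapCLM ℝ E F F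
          (ι := Fin k)).flip p.2).comp (b.comp p.1)) := by
  have h1 : ContDiff ℝ m fun p : (E →L[ℝ] F) × (E [⋀^Fin k]→L[ℝ] F) =>
      ((ContinuousLinearMap.compContinuousAlternatingMapCLM ℝ E F F
          (ι := Fin k)).flip p.2).comp (b.comp p.1) :=
    ((ContinuousLinearMap.contDiff _).comp contDiff_snd).clm_comp
      (contDiff_const.clm_comp contDiff_fst)
  exact contDiff_alternatizeUncurryFin.comp h1

theorem contDiffOn_extDerivWithin {s : Set E} (hs : UniqueDiffOn ℝ s)
    {w : E → E [⋀^Fin k]→L[ℝ] F}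
    (hw : ContDiffOn ℝ m' w s) (hm : m + 1 ≤ m') : ContDiffOn ℝ m (extDerivWithin w s) s :=
  contDiff_alternatizeUncurryFin.comp_contDiffOn (hw.fderivWithin hs hm)

/-- The curvature of a `C^{m+1}` connection is `C^m`. -/
theorem contDiffOn_curvature_form (b : F →L[ℝ] F →L[ℝ] F) {s : Set E} (hs : UniqueDiffOn ℝ s)
    {A : E → E →L[ℝ] F} (hA : ContDiffOn ℝ m' A s) (hm : m + 1 ≤ m') :
    ContDiffOn ℝ m (fun z => extDerivWithin
        (fun y => ContinuousAlternatingMap.ofSubsingleton ℝ E F (0 : Fin 1) (A y)) s z +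
      (2⁻¹ : ℝ) • ContinuousAlternatingMap.alternatizeUncurryFin
        (((ContinuousLinearMap.compContinuousAlternatingMapCLM ℝ E F F (ι := Fin 1)).flip
          (ContinuousAlternatingMap.ofSubsingleton ℝ E F (0 : Fin 1) (A z))).comp
          (b.comp (A z)))) s := by
  have h1 : ContDiffOn ℝ m' (fun y => ContinuousAlternatingMap.ofSubsingleton ℝ E F (0 : Fin 1)
      (A y)) s := contDiff_ofSubsingleton.comp_contDiffOn hA
  have h2 : m ≤ m' := le_self_add.trans hm
  exact (contDiffOn_extDerivWithin hs h1 hm).add (((contDiff_alternatize_bilinear b).comp_contDiffOn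
    ((hA.of_le h2).prodMk (h1.of_le h2))).const_smul _)

end Smoothness

/-! ### Curvature, covariant derivative and Hodge star on coordinate vectors -/

section Hodge

variable {n : ℕ}

theorem contDiff_hodge {k l : ℕ} {m : WithTop ℕ∞} (h : l + k = 4) :
    ContDiff ℝ m fun η : Spacetime [⋀^Fin k]→L[ℝ] Mat n => hodge h η :=
  contDiff_sum_smulRight _ _ _ _

theorem contDiff_oneForm {m : WithTop ℕ∞} :
    ContDiff ℝ m fun a : Spacetime →L[ℝ] Mat n => oneForm a :=
  contDiff_ofSubsingleton

theorem contDiffOn_curvature {A : Spacetime → Spacetime →L[ℝ] Mat n} {m m' : WithTop ℕ∞}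
    (hA : ContDiffOn ℝ m' A diamond) (hm : m + 1 ≤ m') :
    ContDiffOn ℝ m (curvature A) diamond :=
  contDiffOn_curvature_form (ad n) uniqueDiffOn_diamond hA hm

theorem bracket_apply {k : ℕ} (a : Spacetime →L[ℝ] Mat n) (w : Spacetime [⋀^Fin k]→L[ℝ] Mat n)
    (v : Fin (k + 1) → Spacetime) :
    bracket a w v = ∑ i, (-1) ^ i.val •
      (a (v i) * w (i.removeNth v) - w (i.removeNth v) * a (v i)) := by
  rw [bracket, ContinuousAlternatingMap.alternatizeUncurryFin_apply]
  rfl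

theorem covD_apply {k : ℕ} {A : Spacetime → Spacetime →L[ℝ] Mat n}
    {w : Spacetime → Spacetime [⋀^Fin k]→L[ℝ] Mat n} {z : Spacetime} (hz : z ∈ interior diamond)
    (hw : DifferentiableAt ℝ w z) (v : Fin (k + 1) → Spacetime) :
    covD A w z v = ∑ i, (-1) ^ i.val • (fderiv ℝ (fun y => w y (i.removeNth v)) z (v i) +
      (A z (v i) * w z (i.removeNth v) - w z (i.removeNth v) * A z (v i))) := by
  have hn := mem_interior_iff_mem_nhds.1 hz
  rw [covD, ContinuousAlternatingMap.add_apply, bracket_apply,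
    extDerivWithin_apply hw.differentiableWithinAt (uniqueDiffOn_diamond z (interior_subset hz)),
    ← Finset.sum_add_distrib]
  refine Finset.sum_congr rfl fun i _ => ?_
  rw [fderivWithin_of_mem_nhds hn, smul_add]

/-- The components `A_μ` of a connection. -/
def comp (A : Spacetime → Spacetime →L[ℝ] Mat n) (μ : Fin 4) (z : Spacetime) : Mat n :=
  A z (e μ)

/-- The factor 1/2 is cancelled because `[A, A]` contains each commutator twice. -/
theorem curvature_apply {A : Spacetime → Spacetime →L[ℝ] Mat n} {z : Spacetime}
    (hz : z ∈ interior diamond) (hA : DifferentiableAt ℝ A z) (μ ν : Fin 4) :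
    curvature A z ![e μ, e ν] = curvComp (comp A) μ ν z := by
  have hn := mem_interior_iff_mem_nhds.1 hz
  have h1 : DifferentiableAt ℝ (fun y => oneForm (A y)) z :=
    ((contDiff_oneForm (m := 1)).differentiable one_ne_zero _).comp z hA
  have hone : ∀ (a : Spacetime →L[ℝ] Mat n) (v : Fin 1 → Spacetime), oneForm a v = a (v 0) :=
    fun _ _ => rfl
  rw [curvature, ContinuousAlternatingMap.add_apply, ContinuousAlternatingMap.smul_apply,
    bracket_apply, extDerivWithin_apply h1.differentiableWithinAt
      (uniqueDiffOn_diamond z (interior_subset hz))]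
  have hs : ∀ f : Fin (1 + 1) → Mat n, ∑ i, f i = f 0 + f 1 := fun f => Fin.sum_univ_two f
  simp only [fderivWithin_of_mem_nhds hn, hone, hs, Fin.removeNth]
  have hcomp : ∀ μ, comp A μ = fun x => A x (e μ) := fun _ => rfl
  simp only [curvComp, hcomp, pd]
  simp
  module

theorem vol_apply (v : Fin 4 → Spacetime) : vol v = Matrix.det (Matrix.of fun i μ => dx μ (v i)) :=
  rfl

theorem dx_e (μ ν : Fin 4) : dx μ (e ν) = if μ = ν then 1 else 0 := by
  refine Fin.cases ?_ (fun i => ?_) μ <;> refine Fin.cases ?_ (fun j => ?_) ν <;>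
    simp [dx, e, Fin.succ_ne_zero, (Fin.succ_ne_zero _).symm]

theorem hodge_three_apply (T : Spacetime [⋀^Fin 3]→L[ℝ] Mat n) (v : Fin 1 → Spacetime) :
    hodge (k := 3) (l := 1) rfl T v = (6⁻¹ : ℝ) • ∑ α : Fin 3 → Fin 4, (∏ i, g (α i)) •
      vol ![e (α 0), e (α 1), e (α 2), v 0] • T fun i => e (α i) := by
  have hc : ∀ α : Fin 3 → Fin 4, contract (l := 1) 3 (fun i => e (α i)) vol v =
      vol ![e (α 0), e (α 1), e (α 2), v 0] := fun α => by
    have : ∀ w, contract (l := 1) 3 (fun i => e (α i)) vol w =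
      vol (Matrix.vecCons (e (α 0)) (Matrix.vecCons (e (α 1)) (Matrix.vecCons (e (α 2)) w))) :=
      fun w => rfl
    rw [this]
    congr 1
    funext i
    fin_cases i <;> rfl
  simp only [← hc]
  simp [hodge, Nat.factorial]

theorem hodge_two_apply (T : Spacetime [⋀^Fin 2]→L[ℝ] Mat n) (v : Fin 2 → Spacetime) :
    hodge (k := 2) (l := 2) rfl T v = (2⁻¹ : ℝ) • ∑ α : Fin 2 → Fin 4, (∏ i, g (α i)) •
      vol ![e (α 0), e (α 1), v 0, v 1] • T fun i => e (α i) := by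
  have hc : ∀ α : Fin 2 → Fin 4, contract (l := 2) 2 (fun i => e (α i)) vol v =
      vol ![e (α 0), e (α 1), v 0, v 1] := fun α => by
    have : ∀ w, contract (l := 2) 2 (fun i => e (α i)) vol w =
      vol (Matrix.vecCons (e (α 0)) (Matrix.vecCons (e (α 1)) w)) :=
      fun w => rfl
    rw [this]
    congr 1
    funext i
    fin_cases i <;> rfl
  simp only [← hc]
  simp [hodge, Nat.factorial]

end Hodge

/-! ### The spatial components of the source -/

section Source

variable {n : ℕ}

theorem sum_fin_two_fun {ι M : Type*} [Fintype ι] [AddCommMonoid M] (f : (Fin 2 → ι) → M) :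
    ∑ α, f α = ∑ a, ∑ b, f ![a, b] := by
  rw [← (finTwoArrowEquiv ι).symm.sum_comp, Fintype.sum_prod_type]
  rfl

theorem sum_fin_three_fun {ι M : Type*} [Fintype ι] [AddCommMonoid M] (f : (Fin 3 → ι) → M) :
    ∑ α, f α = ∑ a, ∑ b, ∑ c, f ![a, b, c] := by
  rw [← (Fin.consEquiv fun _ : Fin 3 => ι).sum_comp, Fintype.sum_prod_type]
  refine Finset.sum_congr rfl fun a _ => ?_
  rw [sum_fin_two_fun]
  rfl

/-- The Levi-Civita symbol, as a quotient of Vandermonde determinants. -/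
theorem vol_e (a b c d : Fin 4) :
    vol ![e a, e b, e c, e d] = 12⁻¹ * (((b : ℕ) - (a : ℕ) : ℝ) * ((c : ℕ) - (a : ℕ)) *
      ((d : ℕ) - (a : ℕ)) * ((c : ℕ) - (b : ℕ)) * ((d : ℕ) - (b : ℕ)) * ((d : ℕ) - (c : ℕ))) := by
  have hdet : ∀ v : Fin 4 → ℝ, (Matrix.vandermonde v).det =
      (v 1 - v 0) * (v 2 - v 0) * (v 3 - v 0) * (v 2 - v 1) * (v 3 - v 1) * (v 3 - v 2) := by
    intro v
    have h1 : Finset.Ioi (0 : Fin 4) = {1, 2, 3} := by decide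
    have h2 : Finset.Ioi (1 : Fin 4) = {2, 3} := by decide
    have h3 : Finset.Ioi (2 : Fin 4) = {3} := by decide
    have h4 : Finset.Ioi (3 : Fin 4) = ∅ := by decide
    rw [Matrix.det_vandermonde, Fin.prod_univ_four, h1, h2, h3, h4,
      Finset.prod_insert (by decide), Finset.prod_pair (by decide), Finset.prod_pair (by decide),
      Finset.prod_singleton, Finset.prod_empty]
    ring
  -- The coordinate matrix selects rows `a, b, c, d` of the Vandermonde matrix of `0, 1, 2, 3`,
  -- whose determinant is 12. The symbol becomes a polynomial in the indices, which numerical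
  -- simplification can evaluate.
  have hmul : (Matrix.of fun i μ => dx μ (![e a, e b, e c, e d] i)) *
      Matrix.vandermonde (fun i : Fin 4 => ((i : ℕ) : ℝ)) =
      Matrix.vandermonde (fun i : Fin 4 => ((![a, b, c, d] i : ℕ) : ℝ)) := by
    have he : ∀ i, ![e a, e b, e c, e d] i = e (![a, b, c, d] i) := fun i => by
      fin_cases i <;> rfl
    ext i j
    simp [Matrix.mul_apply, he, dx_e, Matrix.vandermonde_apply]
  have h := congrArg Matrix.det hmul
  rw [Matrix.det_mul, ← vol_apply, hdet, hdet] at h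
  simp only [Matrix.cons_val] at h
  rw [← h]
  norm_num
  ring

theorem swap_two {F : Type*} [NormedAddCommGroup F] [NormedSpace ℝ F]
    (T : Spacetime [⋀^Fin 2]→L[ℝ] F) (a b : Spacetime) : T ![b, a] = -T ![a, b] := by
  have : T (![a, b] ∘ Equiv.swap 0 1) = -T ![a, b] :=
    T.toAlternatingMap.map_swap ![a, b] (i := 0) (j := 1) (by decide)
  rw [← this]
  congr 1
  funext i
  fin_cases i <;> rfl

theorem hodge_two_e (T : Spacetime [⋀^Fin 2]→L[ℝ] Mat n) :
    hodge (k := 2) (l := 2) rfl T ![e 2, e 3] = -T ![e 0, e 1] ∧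
    hodge (k := 2) (l := 2) rfl T ![e 1, e 3] = T ![e 0, e 2] ∧
    hodge (k := 2) (l := 2) rfl T ![e 1, e 2] = -T ![e 0, e 3] ∧
    hodge (k := 2) (l := 2) rfl T ![e 0, e 1] = T ![e 2, e 3] ∧
    hodge (k := 2) (l := 2) rfl T ![e 0, e 2] = -T ![e 1, e 3] ∧
    hodge (k := 2) (l := 2) rfl T ![e 0, e 3] = T ![e 1, e 2] := by
  have hT : ∀ a b, (T fun i => e (![a, b] i)) = T ![e a, e b] := fun a b => by
    congr 1
    funext i
    fin_cases i <;> rfl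
  simp only [hodge_two_apply, sum_fin_two_fun, hT, Fin.prod_univ_two, Matrix.cons_val_zero,
    Matrix.cons_val_one, vol_e, Fin.sum_univ_four]
  simp only [swap_two T (e 0) (e 1), swap_two T (e 0) (e 2), swap_two T (e 0) (e 3), swap_two T (e 1) (e 2), swap_two T (e 1) (e 3),
    swap_two T (e 2) (e 3), g]
  refine ⟨?_, ?_, ?_, ?_, ?_, ?_⟩ <;> norm_num [Fin.ext_iff] <;> module

theorem swap_three {F : Type*} [NormedAddCommGroup F] [NormedSpace ℝ F]
    (T : Spacetime [⋀^Fin 3]→L[ℝ] F) (a b c : Spacetime) :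
    T ![a, c, b] = -T ![a, b, c] ∧ T ![b, a, c] = -T ![a, b, c] ∧ T ![b, c, a] = T ![a, b, c] ∧
      T ![c, a, b] = T ![a, b, c] ∧ T ![c, b, a] = -T ![a, b, c] := by
  have h1 : ∀ a b c, T ![a, c, b] = -T ![a, b, c] := fun a b c => by
    have : T (![a, b, c] ∘ Equiv.swap 1 2) = -T ![a, b, c] :=
      T.toAlternatingMap.map_swap ![a, b, c] (i := 1) (j := 2) (by decide)
    rw [← this]
    congr 1
    funext i
    fin_cases i <;> rfl
  have h2 : ∀ a b c, T ![b, a, c] = -T ![a, b, c] := fun a b c => by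
    have : T (![a, b, c] ∘ Equiv.swap 0 1) = -T ![a, b, c] :=
      T.toAlternatingMap.map_swap ![a, b, c] (i := 0) (j := 1) (by decide)
    rw [← this]
    congr 1
    funext i
    fin_cases i <;> rfl
  refine ⟨h1 a b c, h2 a b c, ?_, ?_, ?_⟩
  · rw [h1 b a c, h2 a b c, neg_neg]
  · rw [h2 a c b, h1 a b c, neg_neg]
  · rw [h2 b c a, h1 b a c, h2 a b c, neg_neg]

theorem hodge_three_e (T : Spacetime [⋀^Fin 3]→L[ℝ] Mat n) :
    hodge (k := 3) (l := 1) rfl T ![e 1] = -T ![e 0, e 2, e 3] ∧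
    hodge (k := 3) (l := 1) rfl T ![e 2] = T ![e 0, e 1, e 3] ∧
    hodge (k := 3) (l := 1) rfl T ![e 3] = -T ![e 0, e 1, e 2] := by
  have hT : ∀ a b c, (T fun i => e (![a, b, c] i)) = T ![e a, e b, e c] := fun a b c => by
    congr 1
    funext i
    fin_cases i <;> rfl
  simp only [hodge_three_apply, sum_fin_three_fun, hT, Fin.prod_univ_three, Matrix.cons_val,
    vol_e, Fin.sum_univ_four, g]
  refine ⟨?_, ?_, ?_⟩ <;> norm_num [Fin.ext_iff]
  · obtain ⟨h1, h2, h3, h4, h5⟩ := swap_three T (e 0) (e 2) (e 3)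
    rw [h1, h2, h3, h4, h5]
    module
  · obtain ⟨h1, h2, h3, h4, h5⟩ := swap_three T (e 0) (e 1) (e 3)
    rw [h1, h2, h3, h4, h5]
    module
  · obtain ⟨h1, h2, h3, h4, h5⟩ := swap_three T (e 0) (e 1) (e 2)
    rw [h1, h2, h3, h4, h5]
    module

/-- Derivatives depend only on germs, so the components of `⋆F_A` may be replaced by any expressions
equal to them in the open diamond. -/
theorem covD_hodge_curvature_apply {A : Spacetime → Spacetime →L[ℝ] Mat n}
    (hA : ContDiffOn ℝ 2 A diamond) {z : Spacetime} (hz : z ∈ interior diamond)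
    (u v w : Spacetime) {P Q R : Spacetime → Mat n}
    (hP : ∀ y ∈ interior diamond, hodge (k := 2) (l := 2) rfl (curvature A y) ![v, w] = P y)
    (hQ : ∀ y ∈ interior diamond, hodge (k := 2) (l := 2) rfl (curvature A y) ![u, w] = Q y)
    (hR : ∀ y ∈ interior diamond, hodge (k := 2) (l := 2) rfl (curvature A y) ![u, v] = R y) :
    covD A (fun y => hodge (k := 2) (l := 2) rfl (curvature A y)) z ![u, v, w] =
      (fderiv ℝ P z u + (A z u * P z - P z * A z u)) -
      (fderiv ℝ Q z v + (A z v * Q z - Q z * A z v)) +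
      (fderiv ℝ R z w + (A z w * R z - R z * A z w)) := by
  have hn := mem_interior_iff_mem_nhds.1 hz
  have hd : DifferentiableAt ℝ (fun y => hodge (k := 2) (l := 2) rfl (curvature A y)) z :=
    ((contDiff_hodge (m := 1) rfl).differentiable one_ne_zero _).comp z
      (((contDiffOn_curvature (m := 1) hA (by norm_num)).contDiffAt hn).differentiableAt
        one_ne_zero)
  rw [covD_apply hz hd]
  have hs : ∀ f : Fin (2 + 1) → Mat n, ∑ i, f i = f 0 + f 1 + f 2 := fun f =>
    Fin.sum_univ_three f
  have r0 : (0 : Fin (2 + 1)).removeNth ![u, v, w] = ![v, w] := by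
    funext i; fin_cases i <;> rfl
  have r1 : (1 : Fin (2 + 1)).removeNth ![u, v, w] = ![u, w] := by
    funext i; fin_cases i <;> rfl
  have r2 : (2 : Fin (2 + 1)).removeNth ![u, v, w] = ![u, v] := by
    funext i; fin_cases i <;> rfl
  have hf : ∀ {f h : Spacetime → Mat n}, (∀ y ∈ interior diamond, f y = h y) →
      fderiv ℝ f z = fderiv ℝ h z := fun hfh =>
    (Filter.eventuallyEq_of_mem (isOpen_interior.mem_nhds hz) hfh).fderiv_eq
  rw [hs, r0, r1, r2, hf hP, hf hQ, hf hR, hP z hz, hQ z hz, hR z hz]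
  simp
  abel

/-- The spatial components of `d_A^* F_A`. -/
theorem source_apply {A : Spacetime → Spacetime →L[ℝ] Mat n}
    (hA : ContDiffOn ℝ 2 A diamond) {z : Spacetime} (hz : z ∈ interior diamond) (k : Fin 3) :
    source A z ![e k.succ] = -divComp (comp A) k.succ z := by
  have hF : ∀ μ ν, ∀ y ∈ interior diamond,
      curvature A y ![e μ, e ν] = curvComp (comp A) μ ν y := fun μ ν y hy =>
    curvature_apply hy ((hA.contDiffAt (mem_interior_iff_mem_nhds.1 hy)).differentiableAt
      two_ne_zero) μ ν
  have hneg : ∀ μ ν, curvComp (comp A) μ ν = fun y => -curvComp (comp A) ν μ y := fun μ ν =>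
    funext fun y => curvComp_antisymm _ _ _ _
  have hself : ∀ μ, curvComp (comp A) μ μ = fun _ => 0 := fun μ => by
    funext y
    simp [curvComp]
  have hpn : ∀ μ (f : Spacetime → Mat n), pd μ (fun y => -f y) z = -pd μ f z := fun μ f => by
    simp [pd, fderiv_fun_neg]
  have hc : ∀ μ, A z (e μ) = comp A μ z := fun _ => rfl
  have hp : ∀ μ (f : Spacetime → Mat n), fderiv ℝ f z (e μ) = pd μ f z := fun _ _ => rfl
  have H := fun y => hodge_two_e (curvature A y)
  -- The three slots of `d_A ⋆ F_A` supply the terms of `∇^μ F_{μ1}` with `μ ≠ 1`; the term with `μ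
  -- = 1` vanishes by antisymmetry. The functions `P`, `Q`, `R` are read off from `hodge_two_e`.
  have h1 : source A z ![e 1] = -divComp (comp A) 1 z := by
    rw [source, (hodge_three_e _).1, covD_hodge_curvature_apply hA hz (e 0) (e 2) (e 3)
      (P := fun y => -curvComp (comp A) 0 1 y) (Q := fun y => curvComp (comp A) 1 2 y)
      (R := fun y => -curvComp (comp A) 1 3 y)
      (fun y hy => by rw [(H y).1, hF _ _ y hy])
      (fun y hy => by rw [(H y).2.2.2.2.2, hF _ _ y hy])
      (fun y hy => by rw [(H y).2.2.2.2.1, hF _ _ y hy])]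
    simp only [divComp, Fin.sum_univ_four, hc, hp, hpn, hself, hneg 2 1, hneg 3 1, pd_const]
    simp [g]
    abel
  have h2 : source A z ![e 2] = -divComp (comp A) 2 z := by
    rw [source, (hodge_three_e _).2.1, covD_hodge_curvature_apply hA hz (e 0) (e 1) (e 3)
      (P := fun y => curvComp (comp A) 0 2 y) (Q := fun y => curvComp (comp A) 1 2 y)
      (R := fun y => curvComp (comp A) 2 3 y)
      (fun y hy => by rw [(H y).2.1, hF _ _ y hy])
      (fun y hy => by rw [(H y).2.2.2.2.2, hF _ _ y hy])
      (fun y hy => by rw [(H y).2.2.2.1, hF _ _ y hy])]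
    simp only [divComp, Fin.sum_univ_four, hc, hp, hpn, hself, hneg 3 2, pd_const]
    simp [g]
    abel
  have h3 : source A z ![e 3] = -divComp (comp A) 3 z := by
    rw [source, (hodge_three_e _).2.2, covD_hodge_curvature_apply hA hz (e 0) (e 1) (e 2)
      (P := fun y => -curvComp (comp A) 0 3 y) (Q := fun y => -curvComp (comp A) 1 3 y)
      (R := fun y => curvComp (comp A) 2 3 y)
      (fun y hy => by rw [(H y).2.2.1, hF _ _ y hy])
      (fun y hy => by rw [(H y).2.2.2.2.1, hF _ _ y hy])
      (fun y hy => by rw [(H y).2.2.2.1, hF _ _ y hy])]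
    simp only [divComp, Fin.sum_univ_four, hc, hp, hpn, hself, pd_const]
    simp [g]
    abel
  have hk : k.succ = (1 : Fin 4) ∨ k.succ = (2 : Fin 4) ∨ k.succ = (3 : Fin 4) := by
    revert k
    decide
  rcases hk with hk | hk | hk <;> rw [hk]
  exacts [h1, h2, h3]

end Source

/-! ### Gauge transformations -/

section GaugeAction

variable {n : ℕ}

theorem ext_e {F : Type*} [AddCommGroup F] [Module ℝ F] [TopologicalSpace F]
    {f h : Spacetime →L[ℝ] F} (hfh : ∀ μ, f (e μ) = h (e μ)) : f = h := by
  refine ContinuousLinearMap.ext fun v => ?_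
  have hv : v = v.1 • e 0 + ∑ j : Fin 3, v.2 j • e j.succ := by
    refine Prod.ext ?_ ?_
    · simp [e_zero, e_succ, Prod.fst_sum]
    · ext i
      simp [e_zero, e_succ, Fin.sum_univ_three]
      fin_cases i <;> simp
  rw [hv]
  simp only [map_add, map_sum, map_smul, hfh]

theorem mul_gaugeAct (U : Spacetime → GL (Fin n) ℂ) (B : Spacetime → Spacetime →L[ℝ] Mat n)
    (z v : Spacetime) :
    (U z : Mat n) * gaugeAct U B z v = dGauge U z v + B z v * (U z : Mat n) := by
  have h : gaugeAct U B z v =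
      (((U z)⁻¹ : GL (Fin n) ℂ) : Mat n) * (dGauge U z v + B z v * (U z : Mat n)) := rfl
  rw [h, ← mul_assoc, Units.mul_inv, one_mul]

theorem contDiffOn_gauge_formula {E 𝔸 : Type*} [NormedAddCommGroup E] [NormedSpace ℝ E]
    [NormedRing 𝔸] [NormedAlgebra ℝ 𝔸] {m : WithTop ℕ∞} {s : Set E} {V V' : E → 𝔸}
    {D B : E → E →L[ℝ] 𝔸} (hV : ContDiffOn ℝ m V s) (hV' : ContDiffOn ℝ m V' s)
    (hD : ContDiffOn ℝ m D s) (hB : ContDiffOn ℝ m B s) :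
    ContDiffOn ℝ m (fun z => (ContinuousLinearMap.mul ℝ 𝔸 (V' z)).comp
      (D z + ((ContinuousLinearMap.mul ℝ 𝔸).flip (V z)).comp (B z))) s :=
  ((ContinuousLinearMap.mul ℝ 𝔸).contDiff.comp_contDiffOn hV').clm_comp
    (hD.add (((ContinuousLinearMap.mul ℝ 𝔸).flip.contDiff.comp_contDiffOn hV).clm_comp hB))

theorem contDiffOn_units_inv {E 𝔸 : Type*} [NormedAddCommGroup E] [NormedSpace ℝ E]
    [NormedRing 𝔸] [NormedAlgebra ℝ 𝔸] [CompleteSpace 𝔸] {m : WithTop ℕ∞} {s : Set E}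
    {V : E → 𝔸ˣ} (hV : ContDiffOn ℝ m (fun z => (V z : 𝔸)) s) :
    ContDiffOn ℝ m (fun z => ((V z)⁻¹ : 𝔸ˣ).val) s := by
  have h : (fun z => ((V z)⁻¹ : 𝔸ˣ).val) = fun z => Ring.inverse (V z : 𝔸) :=
    funext fun z => (Ring.inverse_unit (V z)).symm
  rw [h]
  exact fun z hz => ContDiffAt.comp_contDiffWithinAt (g := Ring.inverse) z
    (contDiffAt_ringInverse ℝ (V z)) (hV z hz)

theorem contDiffOn_gaugeAct {V : Spacetime → GL (Fin n) ℂ}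
    {B : Spacetime → Spacetime →L[ℝ] Mat n} {m : WithTop ℕ∞}
    (hV : ContDiffOn ℝ (m + 1) (fun z => (V z : Mat n)) diamond)
    (hB : ContDiffOn ℝ m B diamond) : ContDiffOn ℝ m (gaugeAct V B) diamond := by
  have h1 : ContDiffOn ℝ m (fun z => (V z : Mat n)) diamond := hV.of_le le_self_add
  exact contDiffOn_gauge_formula h1 (contDiffOn_units_inv h1)
    (hV.fderivWithin uniqueDiffOn_diamond le_rfl) hB

theorem gaugeAct_congr {U V : Spacetime → GL (Fin n) ℂ} {B : Spacetime → Spacetime →L[ℝ] Mat n}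
    {M : Set Spacetime} (hM : IsOpen M) (h : ∀ z ∈ M ∩ diamond, V z = U z) {z : Spacetime}
    (hz : z ∈ M ∩ diamond) : gaugeAct V B z = gaugeAct U B z := by
  have hd : dGauge V z = dGauge U z := by
    refine Filter.EventuallyEq.fderivWithin_eq ?_ (by rw [h z hz])
    filter_upwards [inter_mem_nhdsWithin diamond (hM.mem_nhds hz.1)] with y hy
    rw [h y ⟨hy.2, hy.1⟩]
  rw [gaugeAct, gaugeAct, hd, h z hz]

theorem dGauge_time_eq_zero {A B : Spacetime → Spacetime →L[ℝ] Mat n}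
    {U : Spacetime → GL (Fin n) ℂ} {z : Spacetime} (hA : A z (e 0) = 0) (hB : B z (e 0) = 0)
    (h : A z = gaugeAct U B z) : dGauge U z (e 0) = 0 := by
  have := mul_gaugeAct U B z (e 0)
  rw [← h, hA, hB, mul_zero, zero_mul, add_zero] at this
  exact this.symm

/-- A gauge transformation whose time derivative vanishes along a vertical segment is constant on
that segment. -/
theorem gauge_eq_of_dGauge_eq_zero {U : Spacetime → GL (Fin n) ℂ}
    (hU : DifferentiableOn ℝ (fun z => (U z : Mat n)) diamond) {a b : ℝ}
    {x : EuclideanSpace ℝ (Fin 3)} (hab : a ≤ b)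
    (hmem : ∀ s ∈ Icc a b, ((s, x) : Spacetime) ∈ diamond)
    (h0 : ∀ s ∈ Icc a b, dGauge U (s, x) (e 0) = 0) : U (b, x) = U (a, x) := by
  have hder : ∀ s ∈ Icc a b, HasDerivWithinAt (fun s : ℝ => (U (s, x) : Mat n)) 0 (Icc a b) s := by
    intro s hs
    have h1 : HasFDerivWithinAt (fun z => (U z : Mat n)) (dGauge U (s, x)) diamond (s, x) :=
      (hU _ (hmem s hs)).hasFDerivWithinAt
    have h2 : HasDerivWithinAt (fun s : ℝ => ((s, x) : Spacetime)) (e 0) (Icc a b) s :=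
      (hasDerivWithinAt_id s _).prodMk (hasDerivWithinAt_const s _ x)
    have h3 := h1.comp_hasDerivWithinAt s h2 fun s hs => hmem s hs
    rwa [h0 s hs] at h3
  refine Units.ext (constant_of_derivWithin_zero (f := fun s : ℝ => (U (s, x) : Mat n))
    (fun s hs => (hder s hs).differentiableWithinAt) (fun s hs => ?_) b ⟨hab, le_rfl⟩)
  exact (hder s ⟨hs.1, hs.2.le⟩).derivWithin
    (uniqueDiffOn_Icc (hs.1.trans_lt hs.2) s ⟨hs.1, hs.2.le⟩)

/-- The extension of `U` from the lower boundary that does not depend on time. -/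
def timeIndep (U : Spacetime → GL (Fin n) ℂ) (z : Spacetime) : GL (Fin n) ℂ :=
  U (‖z.2‖ - 1, z.2)

theorem lower_mem {x : EuclideanSpace ℝ (Fin 3)} (hx : ‖x‖ ≤ 1) :
    ((‖x‖ - 1, x) : Spacetime) ∈ lowerBdry :=
  ⟨⟨by simp, by simp only; linarith⟩, by simp⟩

theorem norm_snd_le_one {z : Spacetime} (hz : z ∈ diamond) : ‖z.2‖ ≤ 1 := by
  have h1 := hz.1
  have h2 := hz.2
  linarith

/-- The point `(|x| - 1, x)` lies outside the open set `℧`, so the value there is a limit from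
above. The vertical line enters the open diamond because `|x| < ε₀ < 1`. -/
theorem timeIndep_eq_one {U : Spacetime → GL (Fin n) ℂ} {ε₀ : ℝ} (hε₁ : ε₀ < 1)
    (hU : ContinuousOn (fun z => (U z : Mat n)) diamond) {N₁ : Set Spacetime} (hN₁ : IsOpen N₁)
    (hl : lowerBdry ⊆ N₁) (h1 : ∀ z ∈ N₁ ∩ obs ε₀, U z = 1) {z : Spacetime} (hz : ‖z.2‖ < ε₀) :
    timeIndep U z = 1 := by
  obtain ⟨t, x⟩ := z
  simp only at hz
  have hx : ‖x‖ < 1 := hz.trans hε₁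
  have hlow := lower_mem hx.le
  have hcont : Filter.Tendsto (fun s : ℝ => ((‖x‖ - 1 + s, x) : Spacetime)) (𝓝[>] 0)
      (𝓝 (‖x‖ - 1, x)) := by
    have : Continuous fun s : ℝ => ((‖x‖ - 1 + s, x) : Spacetime) := by fun_prop
    simpa using (this.tendsto 0).mono_left nhdsWithin_le_nhds
  have hev : ∀ᶠ s : ℝ in 𝓝[>] 0, ((‖x‖ - 1 + s, x) : Spacetime) ∈ N₁ ∩ obs ε₀ := by
    filter_upwards [hcont.eventually (hN₁.mem_nhds (hl hlow)), self_mem_nhdsWithin,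
      Ioo_mem_nhdsGT (show (0 : ℝ) < 2 - 2 * ‖x‖ by linarith)] with s hs1 hs2 hs3
    refine ⟨hs1, mem_interior_diamond.2 ⟨?_, ?_⟩, hz⟩
    · simp only
      linarith [hs3.1]
    · simp only
      linarith [hs3.2]
  have hlim : Filter.Tendsto (fun s : ℝ => (U (‖x‖ - 1 + s, x) : Mat n)) (𝓝[>] 0)
      (𝓝 (U (‖x‖ - 1, x) : Mat n)) :=
    (hU _ hlow.1).tendsto.comp (tendsto_nhdsWithin_iff.2
      ⟨hcont, hev.mono fun s hs => interior_subset hs.2.1⟩)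
  have hone : Filter.Tendsto (fun s : ℝ => (U (‖x‖ - 1 + s, x) : Mat n)) (𝓝[>] 0) (𝓝 1) :=
    tendsto_const_nhds.congr' (hev.mono fun s hs => by simp [h1 _ hs])
  exact Units.ext (tendsto_nhds_unique hlim hone)

theorem isGauge_timeIndep {G : Subgroup (GL (Fin n) ℂ)} {U : Spacetime → GL (Fin n) ℂ}
    (hU : IsGauge G U) {ε₀ : ℝ} (hε₀ : 0 < ε₀) (h1 : ∀ z : Spacetime, ‖z.2‖ < ε₀ →
      timeIndep U z = 1) : IsGauge G (timeIndep U) where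
  contDiffOn := by
    intro z hz
    by_cases hx : z.2 = 0
    · have : (fun y => (timeIndep U y : Mat n)) =ᶠ[𝓝 z] fun _ => 1 := by
        have ho : IsOpen {y : Spacetime | ‖y.2‖ < ε₀} := isOpen_lt (by fun_prop) (by fun_prop)
        filter_upwards [ho.mem_nhds (show ‖z.2‖ < ε₀ by simpa [hx] using hε₀)] with y hy
        rw [h1 y hy]
        rfl
      exact (contDiffAt_const.congr_of_eventuallyEq this).contDiffWithinAt
    · have hφ : ContDiffAt ℝ ∞ (fun y : Spacetime => ((‖y.2‖ - 1, y.2) : Spacetime)) z :=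
        ((contDiffAt_snd.norm ℝ hx).sub contDiffAt_const).prodMk contDiffAt_snd
      exact ContDiffWithinAt.comp (g := fun y => (U y : Mat n)) z
        (hU.contDiffOn _ (lower_mem (norm_snd_le_one hz)).1) hφ.contDiffWithinAt
        fun y hy => (lower_mem (norm_snd_le_one hy)).1
  mem z hz := hU.mem _ (lower_mem (norm_snd_le_one hz)).1

theorem pd_zero_timeIndep (U : Spacetime → GL (Fin n) ℂ) {z : Spacetime}
    (hd : DifferentiableAt ℝ (fun y => (timeIndep U y : Mat n)) z) :
    pd 0 (fun y => (timeIndep U y : Mat n)) z = 0 := by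
  rw [pd, ← hd.lineDeriv_eq_fderiv, lineDeriv]
  have : (fun t : ℝ => (timeIndep U (z + t • e 0) : Mat n)) = fun _ => (timeIndep U z : Mat n) := by
    funext t
    simp [timeIndep, e_zero]
  rw [this, deriv_const]

theorem exists_nhds_timeIndep_eq {U : Spacetime → GL (Fin n) ℂ}
    (hU : DifferentiableOn ℝ (fun z => (U z : Mat n)) diamond) {N : Set Spacetime} (hN : IsOpen N)
    (hl : lowerBdry ⊆ N) (h0 : ∀ z ∈ N ∩ diamond, dGauge U z (e 0) = 0) :
    ∃ N₂ : Set Spacetime, IsOpen N₂ ∧ lowerBdry ⊆ N₂ ∧ N₂ ∩ diamond ⊆ N ∧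
      ∀ z ∈ N₂ ∩ diamond, timeIndep U z = U z := by
  -- Vertical lines may meet `N` in several pieces. Compactness gives a uniform height `δ` below
  -- which the whole segment down to the lower boundary stays in `N`.
  obtain ⟨δ, hδ, hδN⟩ := isCompact_lowerBdry.exists_thickening_subset_open hN hl
  have hseg : ∀ z : Spacetime, z ∈ diamond → z.1 < ‖z.2‖ - 1 + δ →
      ∀ s ∈ Icc (‖z.2‖ - 1) z.1, ((s, z.2) : Spacetime) ∈ N ∩ diamond := by
    intro z hz hzδ s hs
    refine ⟨hδN (Metric.mem_thickening_iff.2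
      ⟨_, lower_mem (norm_snd_le_one hz), ?_⟩), ?_, ?_⟩
    · rw [Prod.dist_eq, dist_self, max_eq_left dist_nonneg, Real.dist_eq,
        abs_of_nonneg (by linarith [hs.1])]
      linarith [hs.2]
    · simp only
      linarith [hs.1]
    · simp only
      linarith [hs.2, hz.2]
  refine ⟨{z | z.1 < ‖z.2‖ - 1 + δ}, isOpen_lt (by fun_prop) (by fun_prop), ?_, ?_, ?_⟩
  · intro z hz
    have := hz.2
    simp only [mem_ofPred_eq]
    linarith
  · rintro z ⟨hz, hzD⟩
    exact (hseg z hzD hz z.1 ⟨by linarith [hzD.1], le_rfl⟩).1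
  · rintro z ⟨hz, hzD⟩
    exact (gauge_eq_of_dGauge_eq_zero hU (by linarith [hzD.1])
      (fun s hs => (hseg z hzD hz s hs).2) (fun s hs => h0 _ (hseg z hzD hz s hs))).symm

end GaugeAction

/-! ### Uniqueness up to gauge -/

/-- Two connections in temporal gauge with matching sources that are related near the lower boundary
by a time-independent gauge transformation are related by it everywhere. -/
theorem eqOn_gaugeAct_of_source_eq {n : ℕ} {ε₀ : ℝ}
    {A B : Spacetime → Spacetime →L[ℝ] Mat n} (hA : ContDiffOn ℝ 2 A diamond)
    (hB : ContDiffOn ℝ 2 B diamond)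
    (hAYM : ∀ z ∈ diamond \ obs ε₀, source A z = 0)
    (hBYM : ∀ z ∈ diamond \ obs ε₀, source B z = 0)
    (hAB : ∀ z ∈ obs ε₀, source A z = source B z)
    (hAtemp : IsTemporal A) (hBtemp : IsTemporal B) {V : Spacetime → GL (Fin n) ℂ}
    (hV : ContDiffOn ℝ ∞ (fun z => (V z : Mat n)) diamond)
    (hVt : ∀ z ∈ interior diamond, pd 0 (fun y => (V y : Mat n)) z = 0)
    (hV1 : ∀ z ∈ obs ε₀, V z = 1) {M : Set Spacetime} (hM : IsOpen M) (hMl : lowerBdry ⊆ M)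
    (h : ∀ z ∈ M ∩ diamond, A z = gaugeAct V B z) : EqOn A (gaugeAct V B) diamond := by
  have hB' : ContDiffOn ℝ 2 (gaugeAct V B) diamond :=
    contDiffOn_gaugeAct ((contDiffOn_infty.1 hV 3).of_le (by norm_num)) hB
  have hcomp : ∀ {C : Spacetime → Spacetime →L[ℝ] Mat n}, ContDiffOn ℝ 2 C diamond →
      ∀ μ, ContDiffOn ℝ 2 (comp C μ) (interior diamond) := fun hC μ =>
    (hC.mono interior_subset).clm_apply contDiffOn_const
  have hrel : ∀ μ, ∀ z ∈ interior diamond, (V z : Mat n) * comp (gaugeAct V B) μ z =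
      pd μ (fun y => (V y : Mat n)) z + comp B μ z * (V z : Mat n) := by
    intro μ z hz
    rw [comp, mul_gaugeAct, dGauge, fderivWithin_of_mem_nhds (mem_interior_iff_mem_nhds.1 hz)]
    rfl
  have hcancel : ∀ z (X : Mat n), (V z : Mat n) * X = 0 → X = 0 := fun z X hX => by
    simpa using congrArg (fun Y => (((V z)⁻¹ : GL (Fin n) ℂ) : Mat n) * Y) hX
  have hcov := mul_divComp_of_gauge isOpen_interior (hcomp hB') (hcomp hB)
    ((contDiffOn_infty.1 (hV.mono interior_subset) 2).of_le (by norm_num)) hrel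
  have hΩ : EqOn A (gaugeAct V B) (interior diamond) := by
    have key := eqOn_of_divComp_eq (hcomp hA) (hcomp hB')
      (fun z hz => hAtemp z (interior_subset hz))
      (fun z hz => hcancel z _ (by
        rw [hrel 0 z hz, hVt z hz, comp, hBtemp z (interior_subset hz), zero_mul, add_zero]))
      hM hMl (fun μ z hz => by rw [comp, comp, h z ⟨hz.1, interior_subset hz.2⟩])
      (fun k z hz => by
        have hsA := source_apply hA hz k
        have hsB := source_apply hB hz k
        have hc := hcov k.succ z hz
        -- Equality of nonzero sources is not gauge invariant, so `V = 1` is essential in `℧`.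
        -- Elsewhere both sources vanish and covariance suffices.
        by_cases hzo : z ∈ obs ε₀
        · rw [hAB z hzo, hsB] at hsA
          rw [hV1 z hzo, Units.val_one, one_mul, mul_one] at hc
          rw [hc, neg_injective hsA]
        · have hz' : z ∈ diamond \ obs ε₀ := ⟨interior_subset hz, hzo⟩
          rw [hAYM z hz'] at hsA
          rw [hBYM z hz'] at hsB
          rw [neg_eq_zero.1 hsB.symm, zero_mul] at hc
          rw [hcancel z _ hc]
          exact neg_eq_zero.1 hsA.symm)
    exact fun z hz => ext_e fun μ => key μ hz
  -- Both sides are continuous on the diamond, in which its interior is dense.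
  exact hΩ.of_subset_closure hA.continuousOn hB'.continuousOn interior_subset
    closure_interior_diamond.ge

end YM

end

/-! ### From the lower boundary to the whole diamond -/

theorem mainTheorem7 (n : ℕ) (G : Subgroup (GL (Fin n) ℂ))
    (hGcompact : IsCompact (G : Set (GL (Fin n) ℂ)))
    (hGconn : IsConnected (G : Set (GL (Fin n) ℂ)))
    (ε₀ : ℝ) (hε₀ : 0 < ε₀) (hε₁ : ε₀ < 1)
    (A B : YM.Spacetime → YM.Spacetime →L[ℝ] YM.Mat n)
    (hA : YM.IsConnection G A) (hB : YM.IsConnection G B)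
    (hAYM : ∀ z ∈ YM.diamond \ YM.obs ε₀, YM.source A z = 0)
    (hBYM : ∀ z ∈ YM.diamond \ YM.obs ε₀, YM.source B z = 0)
    (hAB : ∀ z ∈ YM.obs ε₀, YM.source A z = YM.source B z)
    (U : YM.Spacetime → GL (Fin n) ℂ) (hU : YM.IsGauge G U)
    (N : Set YM.Spacetime) (hN : IsOpen N) (hNbdry : YM.lowerBdry ⊆ N)
    (hAUB : ∀ z ∈ N ∩ YM.diamond, A z = YM.gaugeAct U B z)
    (hUid : ∃ N₁ : Set YM.Spacetime, IsOpen N₁ ∧ YM.lowerBdry ⊆ N₁ ∧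
      ∀ z ∈ N₁ ∩ YM.obs ε₀, U z = 1)
    (hAtemp : YM.IsTemporal A) (hBtemp : YM.IsTemporal B) :
    (∀ z ∈ N ∩ YM.diamond, YM.dGauge U z (YM.e 0) = 0) ∧
    ∃ V : YM.Spacetime → GL (Fin n) ℂ, YM.IsGauge G V ∧
      (∀ (s t : ℝ) (x : EuclideanSpace ℝ (Fin 3)),
        (s, x) ∈ YM.diamond → (t, x) ∈ YM.diamond → V (s, x) = V (t, x)) ∧
      (∃ N₂ : Set YM.Spacetime, IsOpen N₂ ∧ YM.lowerBdry ⊆ N₂ ∧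
        ∀ z ∈ N₂ ∩ YM.diamond, V z = U z) ∧
      ∀ z ∈ YM.diamond, A z = YM.gaugeAct V B z := by
  have h0 : ∀ z ∈ N ∩ YM.diamond, YM.dGauge U z (YM.e 0) = 0 := fun z hz =>
    YM.dGauge_time_eq_zero (hAtemp z hz.2) (hBtemp z hz.2) (hAUB z hz)
  obtain ⟨N₁, hN₁, hN₁l, hU1⟩ := hUid
  obtain ⟨N₂, hN₂, hN₂l, hN₂N, hVU⟩ := YM.exists_nhds_timeIndep_eq
    (hU.contDiffOn.differentiableOn (by simp)) hN hNbdry h0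
  have hV1 : ∀ z : YM.Spacetime, ‖z.2‖ < ε₀ → YM.timeIndep U z = 1 := fun z hz =>
    YM.timeIndep_eq_one hε₁ hU.contDiffOn.continuousOn hN₁ hN₁l hU1 hz
  have hV := YM.isGauge_timeIndep hU hε₀ hV1
  refine ⟨h0, YM.timeIndep U, hV, fun _ _ _ _ _ => rfl, ⟨N₂, hN₂, hN₂l, hVU⟩, ?_⟩
  refine YM.eqOn_gaugeAct_of_source_eq (hA.contDiffOn.of_le (by norm_num))
    (hB.contDiffOn.of_le (by norm_num)) hAYM hBYM hAB hAtemp hBtemp hV.contDiffOn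
    (fun z hz => YM.pd_zero_timeIndep U ((hV.contDiffOn.contDiffAt
      (mem_interior_iff_mem_nhds.1 hz)).differentiableAt (by simp)))
    (fun z hz => hV1 z hz.2) hN₂ hN₂l fun z hz => ?_
  rw [YM.gaugeAct_congr hN₂ hVU hz]
  exact hAUB z ⟨hN₂N hz, hz.2⟩
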